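/- **Setting.** Let $a=x_0<x_1<\dots<x_m=b$, $I_j=[x_{j-1},x_j)$ for $1\le j<m$ and $I_m=[x_{m-1},x_m]$. For each $j=1,\dots,m$ let $p_j\ge 0$ be an integer and let $w^{(j)}_0,\dots,w^{(j)}_{p_j}$ be positive functions on $[x_{j-1},x_j]$ with $w^{(j)}_l\in C^{p_j-l}([x_{j-1},x_j])$. Let $\mathbb T_j$ be the extended complete Tchebycheff space on $[x_{j-1},x_j]$ spanned by the generalized powers $$w_0^{(j)}(x)\int_{x_{j-1}}^x w_1^{(j)}(y_1)\int_{x_{j-1}}^{y_1}\cdots\int_{x_{j-1}}^{y_{l-1}}w_l^{(j)}(y_l)\,dy_l\cdots dy_1,\qquad l=0,\dots,p_j .$$ Write $\operatorname{jump}_{x,l}(s)=D_-^l s(x)-D_+^l s(x)$. A smoothness vector is $r=(r_0,\dots,r_m)\in\mathbb Z^{m+1}$ with $r_0=r_m=-1$ and $-1\le r_j\le\min\{p_j,p_{j+1}\}$ for $0<j<m$. Let $S_r$ be the space of $s:[a,b]\to\mathbb R$ with $s|_{I_j}\in\mathbb T_j$ for all $j$ and $\operatorname{jump}_{x_j,l}(s)=0$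 for $0\le l\le r_j$, $0<j<m$. Put $N=\sum_{j=1}^m(p_j+1)-\sum_{j=1}^{m-1}(r_j+1)$. The knot vector $u=(u_k)_{k=1}^N$ contains, in increasing order, $x_j$ with multiplicity $p_{j+1}-r_j$ ($0\le j<m$), and $v=(v_k)_{k=1}^N$ contains $x_j$ with multiplicity $p_j-r_j$ ($0<j\le m$). Put $R(j)=\sum_{l=0}^{j-1}(p_{l+1}-r_l)$ and $L(j)=\sum_{l=1}^{j}(p_l-r_l)$. If $u_k=x_j$ and $v_k=x_{j'}$, put $$r_u(k)=p_{j+1}-1-\max\{l\ge0:u_k=u_{k+l}\},\qquad r_v(k)=p_{j'}-1-\max\{l\ge0:v_k=v_{k-l}\}.$$ The *GTB-splines* of $S_r$ are, when they exist, the basis $B_1,\dots,B_N$ of $S_r$ such that, for all $k$, $B_k>0$ on $(u_k,v_k)$, $B_k=0$ off $[u_k,v_k]$, $B_k$ is exactly $C^{r_u(k)}$ at $u_k$ and exactly $C^{r_v(k)}$ at $v_k$ (functions being extended by zero outside $[a,b]$); $\sum_k B_k=1$ on $[a,b]$; and for every $j$ the restrictions to $I_j$ of $B_k$, $R(j)-p_j\le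 k\le R(j)$, span $\mathbb T_j|_{I_j}$. **Theorem (Knot insertion).** Let $\tilde r$ and $r$ be smoothness vectors and $0<i<m$, with $\tilde r_i=r_i+1$ and $\tilde r_j=r_j$ for $j\ne i$; equivalently, the knot vectors $u,v$ of $r$ arise from the knot vectors $\tilde u,\tilde v$ of $\tilde r$ by inserting the single knot $x_i\in(a,b)$ into both. Suppose that $S_{\tilde r}$ and $S_r$ have GTB-splines $\tilde B_1,\dots,\tilde B_{N-1}$ and $B_1,\dots,B_N$. Let $N,L,R$ refer to $r$. Then there are real numbers $\alpha_k,\beta_k$ such that $$\tilde B_k=\alpha_kB_k+\beta_{k+1}B_{k+1}\quad\text{on }[a,b],\qquad 1\le k\le N-1,$$ where 1. $\alpha_k=1$, $\beta_{k+1}=0$ for $1\le k<L(i)$; 2. $\alpha_k>0$, $\operatorname{jump}_{x_i,r_i+1}(B_{k+1})\neq0$ and $\beta_{k+1}=-\alpha_k\,\dfrac{\operatorname{jump}_{x_i,r_i+1}(B_k)}{\operatorname{jump}_{x_i,r_i+1}(B_{k+1})}>0$ for $L(i)\le k\le R(i)$; 3. $\alpha_k=0$, $\beta_{k+1}=1$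 for $R(i)<k<N$; 4. $\alpha_{L(i)}=\beta_{R(i)+1}=1$, and $\alpha_k+\beta_k=1$ for $L(i)<k\le R(i)$; and, with these same numbers, for all real $\tilde d_1,\dots,\tilde d_{N-1}$, $$\sum_{k=1}^{N-1}\tilde d_k\tilde B_k(x)=\sum_{k=1}^{N}d_kB_k(x),\quad x\in[a,b],\qquad d_k=\begin{cases}\tilde d_k,&1\le k\le L(i),\\ \beta_k\tilde d_{k-1}+\alpha_k\tilde d_k,&L(i)<k\le R(i),\\ \tilde d_{k-1},&R(i)<k\le N.\end{cases}$$ -/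

import Mathlib

open Filter Topology

/-- The nested integrals behind generalized powers:
`nestedPower w c j 0 = w j` and
`nestedPower w c j (k+1) y = w j y * ∫ t in c..y, nestedPower w c (j+1) k t`. -/
noncomputable def nestedPower (w : ℕ → ℝ → ℝ) (c : ℝ) : ℕ → ℕ → ℝ → ℝ
  | j, 0 => w j
  | j, k + 1 => fun y => w j y * ∫ t in c..y, nestedPower w c (j + 1) k t

/-- The generalized power
`u_k(y) = w_0(y) ∫_c^y w_1(y_1) ∫_c^{y_1} ⋯ ∫_c^{y_{k-1}} w_k(y_k) dy_k ⋯ dy_1`. -/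
noncomputable def genPower (w : ℕ → ℝ → ℝ) (c : ℝ) (k : ℕ) : ℝ → ℝ :=
  nestedPower w c 0 k

/-- A partition `x 0 < x 1 < ⋯ < x m` of `[x 0, x m]` with, for every element `i = 1, …, m`
(that is, between `x (i-1)` and `x i`), a degree `p i` and positive weights `w i j`, `j ≤ p i`,
of class `C^(p i - j)` on the closed element. Values at indices outside these ranges are
irrelevant. -/
structure TchebPartition where
  m : ℕ
  m_pos : 0 < m
  x : ℕ → ℝ
  x_lt : ∀ i, i < m → x i < x (i + 1)
  p : ℕ → ℕ
  w : ℕ → ℕ → ℝ → ℝ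
  w_contDiffOn : ∀ i, 1 ≤ i → i ≤ m → ∀ j, j ≤ p i →
    ContDiffOn ℝ ((p i - j : ℕ) : WithTop ℕ∞) (w i j) (Set.Icc (x (i - 1)) (x i))
  w_pos : ∀ i, 1 ≤ i → i ≤ m → ∀ j, j ≤ p i → ∀ y ∈ Set.Icc (x (i - 1)) (x i), 0 < w i j y

/-- `D_-^k s(y)`, the limit of the `k`-th derivative of `s` from the left. -/
noncomputable def leftDeriv (k : ℕ) (s : ℝ → ℝ) (y : ℝ) : ℝ :=
  limUnder (𝓝[<] y) (iteratedDeriv k s)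

/-- `D_+^k s(y)`, the limit of the `k`-th derivative of `s` from the right. -/
noncomputable def rightDeriv (k : ℕ) (s : ℝ → ℝ) (y : ℝ) : ℝ :=
  limUnder (𝓝[>] y) (iteratedDeriv k s)

/-- The jump `D_-^k s(y) - D_+^k s(y)`. -/
noncomputable def jump (y : ℝ) (k : ℕ) (s : ℝ → ℝ) : ℝ :=
  leftDeriv k s y - rightDeriv k s y

/-- A piecewise smooth function `s` is exactly `C^ρ` at `y` (`ρ ≥ -1`): its derivatives of order
`0, …, ρ` do not jump at `y`, and the derivative of order `ρ + 1` does. -/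
def IsExactlySmoothAt (ρ : ℤ) (s : ℝ → ℝ) (y : ℝ) : Prop :=
  (∀ j : ℕ, (j : ℤ) ≤ ρ → jump y j s = 0) ∧ jump y (ρ + 1).toNat s ≠ 0

namespace TchebPartition

/-- The element `I_i`: `[x_{i-1}, x_i)` for `i < m` and `[x_{m-1}, x_m]` for `i = m`. -/
def element (T : TchebPartition) (i : ℕ) : Set ℝ :=
  if i = T.m then Set.Icc (T.x (i - 1)) (T.x i) else Set.Ico (T.x (i - 1)) (T.x i)

/-- Restriction of functions to the element `I_i`. -/
def restrictTo (T : TchebPartition) (i : ℕ) : (ℝ → ℝ) →ₗ[ℝ] (T.element i → ℝ) :=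
  LinearMap.funLeft ℝ ℝ Subtype.val

/-- The ECT-space of the `i`-th element, as a space of functions on `I_i`: the span of the
generalized powers `u_0, …, u_{p_i}` of the weights `w_0^{(i)}, …, w_{p_i}^{(i)}`. The base point
of the integrals is `x_{i-1}`; the span does not depend on it. -/
noncomputable def ectSpace (T : TchebPartition) (i : ℕ) : Submodule ℝ (T.element i → ℝ) :=
  Submodule.map (T.restrictTo i)
    (Submodule.span ℝ (genPower (T.w i) (T.x (i - 1)) '' Set.Iic (T.p i)))

/-- Admissible smoothness vectors `r = (r_0, …, r_m)`. -/
def IsSmoothness (T : TchebPartition) (r : ℕ → ℤ) : Prop :=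
  r 0 = -1 ∧ r T.m = -1 ∧
    ∀ i, 1 ≤ i → i < T.m → -1 ≤ r i ∧ r i ≤ min (T.p i : ℤ) (T.p (i + 1) : ℤ)

/-- The generalized Tchebycheffian splines of smoothness `r`. A function on `[x_0, x_m]` is
represented by its extension by zero to `ℝ`. -/
def splineSpace (T : TchebPartition) (r : ℕ → ℤ) : Set (ℝ → ℝ) :=
  {s | (∀ y, y ∉ Set.Icc (T.x 0) (T.x T.m) → s y = 0) ∧
    (∀ i, 1 ≤ i → i ≤ T.m → T.restrictTo i s ∈ T.ectSpace i) ∧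
    ∀ i, 1 ≤ i → i < T.m → ∀ j : ℕ, (j : ℤ) ≤ r i → jump (T.x i) j s = 0}

/-- `N = ∑_{i=1}^m (p_i + 1) - ∑_{i=1}^{m-1} (r_i + 1)`, the dimension of the spline space. -/
def N (T : TchebPartition) (r : ℕ → ℤ) : ℕ :=
  (∑ i ∈ Finset.Icc 1 T.m, ((T.p i : ℤ) + 1) - ∑ i ∈ Finset.Icc 1 (T.m - 1), (r i + 1)).toNat

/-- Multiplicity `p_{i+1} - r_i` of `x_i` in the knot vector `u`, `0 ≤ i ≤ m - 1`. -/
def uMult (T : TchebPartition) (r : ℕ → ℤ) (i : ℕ) : ℕ := ((T.p (i + 1) : ℤ) - r i).toNat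

/-- Multiplicity `p_i - r_i` of `x_i` in the knot vector `v`, `1 ≤ i ≤ m`. -/
def vMult (T : TchebPartition) (r : ℕ → ℤ) (i : ℕ) : ℕ := ((T.p i : ℤ) - r i).toNat

/-- Breakpoint indices of the knot vector `u`: each `i = 0, …, m - 1`, in increasing order,
`p_{i+1} - r_i` times. -/
def uIndices (T : TchebPartition) (r : ℕ → ℤ) : List ℕ :=
  (List.range T.m).flatMap fun i => List.replicate (T.uMult r i) i

/-- Breakpoint indices of the knot vector `v`: each `i = 1, …, m`, in increasing order,
`p_i - r_i` times. -/
def vIndices (T : TchebPartition) (r : ℕ → ℤ) : List ℕ :=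
  (List.range T.m).flatMap fun i => List.replicate (T.vMult r (i + 1)) (i + 1)

/-- The index `i` with `u_k = x_i`, for `1 ≤ k ≤ N`. -/
def uIdx (T : TchebPartition) (r : ℕ → ℤ) (k : ℕ) : ℕ := (T.uIndices r).getD (k - 1) 0

/-- The index `j` with `v_k = x_j`, for `1 ≤ k ≤ N`. -/
def vIdx (T : TchebPartition) (r : ℕ → ℤ) (k : ℕ) : ℕ := (T.vIndices r).getD (k - 1) 0

/-- The knot `u_k`, `1 ≤ k ≤ N`. -/
def u (T : TchebPartition) (r : ℕ → ℤ) (k : ℕ) : ℝ := T.x (T.uIdx r k)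

/-- The knot `v_k`, `1 ≤ k ≤ N`. -/
def v (T : TchebPartition) (r : ℕ → ℤ) (k : ℕ) : ℝ := T.x (T.vIdx r k)

/-- `R(i) = ∑_{j=0}^{i-1} (p_{j+1} - r_j)`. -/
def R (T : TchebPartition) (r : ℕ → ℤ) (i : ℕ) : ℕ := ∑ j ∈ Finset.range i, T.uMult r j

/-- `L(i) = ∑_{j=1}^{i} (p_j - r_j)`. -/
def L (T : TchebPartition) (r : ℕ → ℤ) (i : ℕ) : ℕ := ∑ j ∈ Finset.Icc 1 i, T.vMult r j

/-- `r_u(k) = p_{i+1} - 1 - max {l ≥ 0 : u_k = u_{k+l}}`, where `u_k = x_i`. -/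
noncomputable def ru (T : TchebPartition) (r : ℕ → ℤ) (k : ℕ) : ℤ :=
  (T.p (T.uIdx r k + 1) : ℤ) - 1 - (sSup {l : ℕ | k + l ≤ T.N r ∧ T.u r k = T.u r (k + l)} : ℕ)

/-- `r_v(k) = p_j - 1 - max {l ≥ 0 : v_k = v_{k-l}}`, where `v_k = x_j`. -/
noncomputable def rv (T : TchebPartition) (r : ℕ → ℤ) (k : ℕ) : ℤ :=
  (T.p (T.vIdx r k) : ℤ) - 1 - (sSup {l : ℕ | l < k ∧ T.v r k = T.v r (k - l)} : ℕ)

/-- `B 1, …, B N` are the GTB-splines of the spline space of smoothness `r`: the B-spline-like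
basis of that space normalized to a partition of unity. (There is at most one such family on the
indices `1, …, N`.) Smoothness at the end points of `[x_0, x_m]` refers to the extension by
zero. -/
structure IsGTBSplines (T : TchebPartition) (r : ℕ → ℤ) (B : ℕ → ℝ → ℝ) : Prop where
  linearIndep : LinearIndepOn ℝ B (Set.Icc 1 (T.N r))
  span_eq : (Submodule.span ℝ (B '' Set.Icc 1 (T.N r)) : Set (ℝ → ℝ)) = T.splineSpace r
  pos : ∀ k, 1 ≤ k → k ≤ T.N r → ∀ y ∈ Set.Ioo (T.u r k) (T.v r k), 0 < B k y
  support : ∀ k, 1 ≤ k → k ≤ T.N r → ∀ y, y ∉ Set.Icc (T.u r k) (T.v r k) → B k y = 0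
  sum_eq_one : ∀ y ∈ Set.Icc (T.x 0) (T.x T.m), ∑ k ∈ Finset.Icc 1 (T.N r), B k y = 1
  start_smooth : ∀ k, 1 ≤ k → k ≤ T.N r → IsExactlySmoothAt (T.ru r k) (B k) (T.u r k)
  end_smooth : ∀ k, 1 ≤ k → k ≤ T.N r → IsExactlySmoothAt (T.rv r k) (B k) (T.v r k)
  local_span : ∀ i, 1 ≤ i → i ≤ T.m →
    Submodule.map (T.restrictTo i)
      (Submodule.span ℝ (B '' Set.Icc (T.R r i - T.p i) (T.R r i))) = T.ectSpace i

/-- The knot vectors of smoothness `r` arise from those of smoothness `r'` by inserting the single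
knot `x_i`, `0 < i < m`, into both: each multiplicity of `x_i` grows by one and the others
stay, i.e. `r'_i = r_i + 1` and `r'_j = r_j` for `j ≠ i`. -/
def IsKnotInsertion (T : TchebPartition) (r' r : ℕ → ℤ) (i : ℕ) : Prop :=
  0 < i ∧ i < T.m ∧ r' i = r i + 1 ∧ ∀ j, j ≤ T.m → j ≠ i → r' j = r j

/-- The coefficients after knot insertion: `d'_k` for `k ≤ L(i)`,
`β_k d'_{k-1} + α_k d'_k` for `L(i) < k ≤ R(i)`, and `d'_{k-1}` for `k > R(i)`. -/
noncomputable def insertedCoeff (T : TchebPartition) (r : ℕ → ℤ) (i : ℕ) (α β d' : ℕ → ℝ)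
    (k : ℕ) : ℝ :=
  if k ≤ T.L r i then d' k
  else if k ≤ T.R r i then β k * d' (k - 1) + α k * d' k
  else d' (k - 1)

end TchebPartition

/-!
The coarse space is contained in the fine one, so each coarse spline `B' k` is a combination of the
fine splines. On every element `(x_a, x_{a+1})` the `p_{a+1} + 1` fine splines living there span a
space of that dimension, by linear independence of the generalized powers
(`nestedPower_coeff_eq_zero`), and are therefore linearly independent
(`TchebPartition.IsGTBSplines.coeff_eq_zero_of_Ioo`). Hence no fine spline that starts before
`B' k` takes part. The fine splines starting at the same knot do so with pairwise distinct orders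
of smoothness, so none that is rougher there than `B' k` takes part either
(`coeff_eq_zero_of_start`); likewise at the right end (`coeff_eq_zero_of_end`). Counting knots,
inserting `x_i` leaves only `B k` and `B (k + 1)` (`IsKnotInsertion.start_eq`, `end_eq`).

The first nonvanishing one-sided derivative at an end of the support of a nonnegative function has
a definite sign (`pos_of_tendsto_iteratedDeriv_right`). At the start of `B' k` only `B k`
contributes to it, at the end only `B (k + 1)`; this makes the two coefficients positive when both
splines are needed. Since the derivative of order `r_i + 1` of `B' k` does not jump at `x_i`, the
jumps of `B k` and `B (k + 1)` determine the ratio of the coefficients. The jump of `B (L i)` is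
nonzero, because this spline ends at `x_i` and is exactly `C^{r_i}` there, and the relation carries
this over to the next ones. Finally, comparing the two partitions of unity gives
`α k + β k = 1`, and from this the values of the coefficients outside the middle range and the
formula for the new coefficients.
-/

/-! ### One-sided limits of derivatives -/

/-- `f` is `C^n` at the points along `l`, and its `n`-th derivative tends to `d` along `l`. With
`l = 𝓝[<] y` or `l = 𝓝[>] y` this says that the one-sided derivative of order `n` exists as a
genuine limit; the smoothness makes the notion linear in `f`. -/
def DerivTendsto (n : ℕ) (f : ℝ → ℝ) (l : Filter ℝ) (d : ℝ) : Prop :=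
  (∀ᶠ z in l, ContDiffAt ℝ n f z) ∧ Tendsto (iteratedDeriv n f) l (𝓝 d)

theorem DerivTendsto.sum {ι : Type*} {n : ℕ} {l : Filter ℝ} {s : Finset ι} {f : ι → ℝ → ℝ}
    {d : ι → ℝ} (h : ∀ i ∈ s, DerivTendsto n (f i) l (d i)) (c : ι → ℝ) :
    DerivTendsto n (fun y => ∑ i ∈ s, c i * f i y) l (∑ i ∈ s, c i * d i) := by
  have hev : ∀ᶠ z in l, ∀ i ∈ s, ContDiffAt ℝ n (f i) z :=
    (Finset.eventually_all s).2 fun i hi => (h i hi).1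
  constructor
  · filter_upwards [hev] with z hz
    exact ContDiffAt.sum fun i hi => contDiffAt_const.mul (hz i hi)
  · refine (tendsto_finsetSum s fun i hi => (h i hi).2.const_mul (c i)).congr' ?_
    filter_upwards [hev] with z hz
    rw [iteratedDeriv_fun_sum fun i hi => contDiffAt_const.mul (hz i hi)]
    refine Finset.sum_congr rfl fun i hi => ?_
    rw [iteratedDeriv_const_mul (c i) (hz i hi)]

theorem derivTendsto_zero {n : ℕ} {f : ℝ → ℝ} {l : Filter ℝ} {U : Set ℝ} (hU : IsOpen U)
    (hl : U ∈ l) (hf : ∀ y ∈ U, f y = 0) : DerivTendsto n f l 0 := by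
  have h0 : ∀ z ∈ U, f =ᶠ[𝓝 z] fun _ => 0 := fun z hz =>
    (hU.mem_nhds hz |> Filter.mem_of_superset) fun y hy => hf y hy
  constructor
  · filter_upwards [hl] with z hz
    exact contDiffAt_const.congr_of_eventuallyEq (h0 z hz)
  · refine tendsto_const_nhds.congr' ?_
    filter_upwards [hl] with z hz
    rw [(h0 z hz).iteratedDeriv_eq]
    simp

theorem DerivTendsto.eq_rightDeriv {n : ℕ} {f : ℝ → ℝ} {y d : ℝ}
    (h : DerivTendsto n f (𝓝[>] y) d) : rightDeriv n f y = d :=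
  h.2.limUnder_eq

theorem DerivTendsto.eq_leftDeriv {n : ℕ} {f : ℝ → ℝ} {y d : ℝ}
    (h : DerivTendsto n f (𝓝[<] y) d) : leftDeriv n f y = d :=
  h.2.limUnder_eq

/-- A function that coincides in the open interval with one that is smooth up to the boundary
has one-sided derivatives at both end points. -/
theorem exists_derivTendsto_of_contDiffOn {n : ℕ} {f g : ℝ → ℝ} {c d : ℝ} (hcd : c < d)
    (hg : ContDiffOn ℝ n g (Set.Icc c d)) (hfg : ∀ y ∈ Set.Ioo c d, f y = g y) :
    (∃ e, DerivTendsto n f (𝓝[>] c) e) ∧ ∃ e, DerivTendsto n f (𝓝[<] d) e := by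
  have hu := uniqueDiffOn_Icc hcd
  have hfg' : ∀ z ∈ Set.Ioo c d, f =ᶠ[𝓝 z] g := fun z hz =>
    Filter.mem_of_superset (isOpen_Ioo.mem_nhds hz) fun y hy => hfg y hy
  have hgz : ∀ z ∈ Set.Ioo c d, ContDiffAt ℝ n g z := fun z hz =>
    hg.contDiffAt (Icc_mem_nhds hz.1 hz.2)
  have hcont := hg.continuousOn_iteratedDerivWithin le_rfl hu
  have key : ∀ (l : Filter ℝ) (e : ℝ), e ∈ Set.Icc c d → l ≤ 𝓝 e → Set.Ioo c d ∈ l →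
      DerivTendsto n f l (iteratedDerivWithin n g (Set.Icc c d) e) := by
    intro l e he hle hl
    constructor
    · filter_upwards [hl] with z hz
      exact (hgz z hz).congr_of_eventuallyEq (hfg' z hz)
    · have hle' : l ≤ 𝓝[Set.Icc c d] e :=
        le_inf hle (le_principal_iff.2 (mem_of_superset hl Set.Ioo_subset_Icc_self))
      refine ((hcont e he).mono_left hle').congr' ?_
      filter_upwards [hl] with z hz
      rw [(hfg' z hz).iteratedDeriv_eq,
        iteratedDerivWithin_eq_iteratedDeriv hu (hgz z hz) (Set.Ioo_subset_Icc_self hz)]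
  exact ⟨⟨_, key _ c (Set.left_mem_Icc.2 hcd.le) nhdsWithin_le_nhds (Ioo_mem_nhdsGT hcd)⟩,
    ⟨_, key _ d (Set.right_mem_Icc.2 hcd.le) nhdsWithin_le_nhds (Ioo_mem_nhdsLT hcd)⟩⟩

/-- The first nonvanishing derivative from the right of a nonnegative function is positive:
if it were negative, so would be all the lower ones near the point, down to the function. -/
theorem pos_of_tendsto_iteratedDeriv_right {n : ℕ} {f : ℝ → ℝ} {c d D : ℝ} (hcd : c < d)
    (hpos : ∀ y ∈ Set.Ioo c d, 0 ≤ f y)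
    (h0 : ∀ j < n, Tendsto (iteratedDeriv j f) (𝓝[>] c) (𝓝 0))
    (hn : Tendsto (iteratedDeriv n f) (𝓝[>] c) (𝓝 D)) (hD : D ≠ 0) : 0 < D := by
  by_contra hD'
  have hneg : D < 0 := lt_of_le_of_ne (not_lt.1 hD') hD
  obtain ⟨e, hce, he⟩ := (mem_nhdsGT_iff_exists_Ioo_subset).1
    ((hn.eventually (gt_mem_nhds hneg)).and (Ioo_mem_nhdsGT hcd))
  have hce : c < e := hce
  have key : ∀ j ≤ n, ∀ y ∈ Set.Ioo c e, iteratedDeriv (n - j) f y < 0 := by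
    intro j
    induction j with
    | zero => exact fun _ y hy => (he hy).1
    | succ j ih =>
      intro hj
      have hsucc : n - j = n - (j + 1) + 1 := by omega
      have hder : ∀ y ∈ Set.Ioo c e, deriv (iteratedDeriv (n - (j + 1)) f) y < 0 := by
        intro y hy
        rw [← iteratedDeriv_succ, ← hsucc]
        exact ih (by omega) y hy
      have hanti : StrictAntiOn (iteratedDeriv (n - (j + 1)) f) (Set.Ioo c e) := by
        refine strictAntiOn_of_deriv_neg (convex_Ioo c e) (fun y hy => ?_) (by simpa using hder)
        exact (differentiableAt_of_deriv_ne_zero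
          (hder y hy).ne).continuousAt.continuousWithinAt
      intro y hy
      obtain ⟨z, hz⟩ := exists_between hy.1
      refine (hanti ⟨hz.1, hz.2.trans hy.2⟩ hy hz.2).trans_le ?_
      refine ge_of_tendsto (h0 (n - (j + 1)) (by omega)) ?_
      filter_upwards [Ioo_mem_nhdsGT hz.1] with t ht
      exact (hanti ⟨ht.1, ht.2.trans (hz.2.trans hy.2)⟩ ⟨hz.1, hz.2.trans hy.2⟩ ht.2).le
  obtain ⟨y, hy⟩ := exists_between hce
  have := key n le_rfl y hy
  rw [Nat.sub_self, iteratedDeriv_zero] at this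
  exact absurd (hpos y (he hy).2) (not_le.2 this)

/-- The first nonvanishing derivative from the left of a nonnegative function has the sign
`(-1) ^ n`, where `n` is its order. -/
theorem pos_of_tendsto_iteratedDeriv_left {n : ℕ} {f : ℝ → ℝ} {c d D : ℝ} (hcd : c < d)
    (hpos : ∀ y ∈ Set.Ioo c d, 0 ≤ f y)
    (h0 : ∀ j < n, Tendsto (iteratedDeriv j f) (𝓝[<] d) (𝓝 0))
    (hn : Tendsto (iteratedDeriv n f) (𝓝[<] d) (𝓝 D)) (hD : D ≠ 0) : 0 < (-1) ^ n * D := by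
  have hneg : Tendsto (fun y : ℝ => -y) (𝓝[>] (-d)) (𝓝[<] d) := by
    simpa using tendsto_neg_nhdsGT (a := -d)
  have hfun : ∀ j, iteratedDeriv j (fun y => f (-y)) =
      fun y => (-1 : ℝ) ^ j * iteratedDeriv j f (-y) := fun j => by
    ext y
    rw [iteratedDeriv_comp_neg, smul_eq_mul]
  refine pos_of_tendsto_iteratedDeriv_right (f := fun y => f (-y)) (c := -d) (d := -c) (n := n)
    (neg_lt_neg hcd) (fun y hy => hpos _ ⟨by linarith [hy.2], by linarith [hy.1]⟩)
    (fun j hj => ?_) ?_ (mul_ne_zero (pow_ne_zero _ (by norm_num)) hD)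
  · rw [hfun]
    simpa using ((h0 j hj).comp hneg).const_mul ((-1 : ℝ) ^ j)
  · rw [hfun]
    exact (hn.comp hneg).const_mul _

/-! ### Generalized powers -/

section nestedPower

variable {w : ℕ → ℝ → ℝ} {c d : ℝ} {p : ℕ}

theorem hasDerivWithinAt_integral_Icc {f : ℝ → ℝ} (hf : ContinuousOn f (Set.Icc c d)) {y : ℝ}
    (hy : y ∈ Set.Icc c d) :
    HasDerivWithinAt (fun y => ∫ t in c..y, f t) (f y) (Set.Icc c d) y := by
  have : Fact (y ∈ Set.Icc c d) := ⟨hy⟩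
  refine intervalIntegral.integral_hasDerivWithinAt_right ?_
    (hf.stronglyMeasurableAtFilter_nhdsWithin measurableSet_Icc y) (hf y hy)
  exact (hf.mono (Set.Icc_subset_Icc_right hy.2)).intervalIntegrable_of_Icc hy.1

theorem contDiffOn_integral_Icc (hcd : c < d) {n : ℕ} {f : ℝ → ℝ}
    (hf : ContDiffOn ℝ n f (Set.Icc c d)) :
    ContDiffOn ℝ (n + 1 : ℕ) (fun y => ∫ t in c..y, f t) (Set.Icc c d) := by
  have hu := uniqueDiffOn_Icc hcd
  have hd := fun y hy => hasDerivWithinAt_integral_Icc hf.continuousOn (y := y) hy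
  rw [Nat.cast_add, Nat.cast_one, contDiffOn_succ_iff_derivWithin hu]
  refine ⟨fun y hy => (hd y hy).differentiableWithinAt, by simp, ?_⟩
  exact hf.congr fun y hy => (hd y hy).derivWithin (hu y hy)

theorem contDiffOn_nestedPower (hcd : c < d)
    (hw : ∀ j ≤ p, ContDiffOn ℝ ((p - j : ℕ) : WithTop ℕ∞) (w j) (Set.Icc c d)) :
    ∀ k j, j + k ≤ p →
      ContDiffOn ℝ ((p - j : ℕ) : WithTop ℕ∞) (nestedPower w c j k) (Set.Icc c d) := by
  intro k
  induction k with
  | zero => exact fun j hj => hw j (by omega)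
  | succ k ih =>
    intro j hj
    have h := contDiffOn_integral_Icc hcd (ih (j + 1) (by omega))
    rw [show p - (j + 1) + 1 = p - j by omega] at h
    exact (hw j (by omega)).mul h

/-- A function continuous on a closed interval that vanishes inside vanishes at the end points. -/
theorem eq_zero_on_Icc_of_Ioo (hcd : c < d) {f : ℝ → ℝ} (hf : ContinuousOn f (Set.Icc c d))
    (h : ∀ y ∈ Set.Ioo c d, f y = 0) : ∀ y ∈ Set.Icc c d, f y = 0 := by
  have : Set.EqOn f (fun _ => 0) (Set.Icc c d) :=
    Set.EqOn.of_subset_closure (s := Set.Ioo c d) h hf continuousOn_const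
      Set.Ioo_subset_Icc_self (by rw [closure_Ioo hcd.ne])
  exact this

/-- Linear independence of the nested integrals: at the base point only the first one is nonzero,
and the others, divided by `w j`, have as derivatives the nested integrals one level down. -/
theorem nestedPower_coeff_eq_zero (hcd : c < d)
    (hw : ∀ j ≤ p, ContDiffOn ℝ ((p - j : ℕ) : WithTop ℕ∞) (w j) (Set.Icc c d))
    (hpos : ∀ j ≤ p, ∀ y ∈ Set.Icc c d, 0 < w j y) :
    ∀ n j, j + n ≤ p → ∀ a : ℕ → ℝ,
      (∀ y ∈ Set.Ioo c d, ∑ k ∈ Finset.range (n + 1), a k * nestedPower w c j k y = 0) →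
      ∀ k ≤ n, a k = 0 := by
  intro n
  induction n with
  | zero =>
    intro j hj a ha k hk
    obtain ⟨y, hy⟩ := exists_between hcd
    have h := ha y hy
    obtain rfl : k = 0 := by omega
    simp only [zero_add, Finset.range_one, Finset.sum_singleton, nestedPower] at h
    exact (mul_eq_zero.1 h).resolve_right
      (hpos j (by omega) y (Set.Ioo_subset_Icc_self hy)).ne'
  | succ n ih =>
    intro j hj a ha
    have hcont : ∀ k ≤ n + 1, ContinuousOn (nestedPower w c j k) (Set.Icc c d) := fun k hk =>
      (contDiffOn_nestedPower hcd hw k j (by omega)).continuousOn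
    have hcont' : ∀ k ≤ n, ContinuousOn (nestedPower w c (j + 1) k) (Set.Icc c d) := fun k hk =>
      (contDiffOn_nestedPower hcd hw k (j + 1) (by omega)).continuousOn
    have hIcc := eq_zero_on_Icc_of_Ioo hcd (f := fun y =>
      ∑ k ∈ Finset.range (n + 1 + 1), a k * nestedPower w c j k y)
      (continuousOn_finsetSum _ fun k hk =>
        continuousOn_const.mul (hcont k (by simp at hk; omega))) ha
    have hwj : ∀ y ∈ Set.Icc c d, w j y ≠ 0 := fun y hy => (hpos j (by omega) y hy).ne'
    have ha0 : a 0 = 0 := by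
      have h := hIcc c (Set.left_mem_Icc.2 hcd.le)
      simp only [Finset.sum_range_succ' _ (n + 1), nestedPower, intervalIntegral.integral_same,
        mul_zero, Finset.sum_const_zero, zero_add] at h
      exact (mul_eq_zero.1 h).resolve_right (hwj c (Set.left_mem_Icc.2 hcd.le))
    have hint : ∀ y ∈ Set.Icc c d,
        ∑ k ∈ Finset.range (n + 1), a (k + 1) * ∫ t in c..y, nestedPower w c (j + 1) k t = 0 := by
      intro y hy
      have h := hIcc y hy
      simp only [Finset.sum_range_succ' _ (n + 1), ha0, zero_mul, add_zero, nestedPower] at h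
      refine (mul_eq_zero.1 (?_ : w j y * _ = 0)).resolve_left (hwj y hy)
      rw [← h, Finset.mul_sum]
      exact Finset.sum_congr rfl fun k _ => by ring
    have hder : ∀ y ∈ Set.Ioo c d,
        ∑ k ∈ Finset.range (n + 1), a (k + 1) * nestedPower w c (j + 1) k y = 0 := by
      intro y hy
      have hy' := Set.Ioo_subset_Icc_self hy
      have h1 : HasDerivWithinAt (fun y => ∑ k ∈ Finset.range (n + 1),
          a (k + 1) * ∫ t in c..y, nestedPower w c (j + 1) k t)
          (∑ k ∈ Finset.range (n + 1), a (k + 1) * nestedPower w c (j + 1) k y)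
          (Set.Icc c d) y :=
        HasDerivWithinAt.fun_sum fun k hk => (hasDerivWithinAt_integral_Icc
          (hcont' k (by simp at hk; omega)) hy').const_mul _
      have h2 : HasDerivWithinAt (fun y => ∑ k ∈ Finset.range (n + 1),
          a (k + 1) * ∫ t in c..y, nestedPower w c (j + 1) k t) 0 (Set.Icc c d) y :=
        (hasDerivWithinAt_const y _ 0).congr hint (hint y hy')
      exact (uniqueDiffOn_Icc hcd y hy').eq_deriv _ h1 h2
    intro k hk
    cases k with
    | zero => exact ha0
    | succ k => exact ih (j + 1) (by omega) (fun k => a (k + 1)) hder k (by omega)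

end nestedPower

/-! ### Knot indices -/

/-- Position `n` of the list in which each `g 0, g 1, …` is repeated `f 0, f 1, …` times. -/
theorem getD_flatMap_replicate (f g : ℕ → ℕ) (m : ℕ) :
    ((List.range m).flatMap fun i => List.replicate (f i) (g i)).length
        = ∑ i ∈ Finset.range m, f i ∧
      ∀ a < m, ∀ n, ∑ i ∈ Finset.range a, f i ≤ n → n < ∑ i ∈ Finset.range (a + 1), f i →
        ((List.range m).flatMap fun i => List.replicate (f i) (g i)).getD n 0 = g a := by
  induction m with
  | zero => simp
  | succ m ih =>
    rw [List.range_succ, List.flatMap_append, List.flatMap_singleton]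
    refine ⟨by rw [List.length_append, ih.1, List.length_replicate, Finset.sum_range_succ], ?_⟩
    intro a ha n h1 h2
    rcases Nat.lt_succ_iff_lt_or_eq.1 ha with h | rfl
    · have hle : ∑ i ∈ Finset.range (a + 1), f i ≤ ∑ i ∈ Finset.range m, f i :=
        Finset.sum_le_sum_of_subset (Finset.range_subset_range.2 h)
      rw [List.getD_append _ _ _ _ (by rw [ih.1]; omega)]
      exact ih.2 a h n h1 h2
    · rw [Finset.sum_range_succ] at h2
      rw [List.getD_append_right _ _ _ _ (by rw [ih.1]; exact h1), ih.1,
        List.getD_eq_getElem _ _ (by rw [List.length_replicate]; omega), List.getElem_replicate]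

/-- A monotone sequence starting at zero partitions the positive integers up to `S m` into the
blocks `(S a, S (a + 1)]`. -/
theorem exists_block {S : ℕ → ℕ} (h0 : S 0 = 0) {m k : ℕ} (hk : 1 ≤ k) (hkm : k ≤ S m) :
    ∃ a < m, S a < k ∧ k ≤ S (a + 1) := by
  induction m with
  | zero => omega
  | succ m ih =>
    by_cases h : k ≤ S m
    · obtain ⟨a, ha, h⟩ := ih h
      exact ⟨a, by omega, h⟩
    · exact ⟨m, by omega, by omega, hkm⟩

namespace TchebPartition

variable {T : TchebPartition} {r : ℕ → ℤ}

theorem x_lt_x (T : TchebPartition) {a b : ℕ} (hab : a < b) (hb : b ≤ T.m) : T.x a < T.x b := by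
  induction b with
  | zero => omega
  | succ b ih =>
    rcases Nat.lt_succ_iff_lt_or_eq.1 hab with h | rfl
    · exact (ih h (by omega)).trans (T.x_lt b (by omega))
    · exact T.x_lt a (by omega)

theorem x_le_x (T : TchebPartition) {a b : ℕ} (hab : a ≤ b) (hb : b ≤ T.m) : T.x a ≤ T.x b := by
  rcases hab.eq_or_lt with rfl | h
  · exact le_rfl
  · exact (T.x_lt_x h hb).le

theorem x_inj (T : TchebPartition) {a b : ℕ} (ha : a ≤ T.m) (hb : b ≤ T.m)
    (h : T.x a = T.x b) : a = b := by
  rcases lt_trichotomy a b with h' | h' | h'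
  · exact absurd h (T.x_lt_x h' hb).ne
  · exact h'
  · exact absurd h (T.x_lt_x h' ha).ne'

theorem R_zero : T.R r 0 = 0 := rfl

theorem L_zero : T.L r 0 = 0 := rfl

theorem R_succ (a : ℕ) : T.R r (a + 1) = T.R r a + T.uMult r a := Finset.sum_range_succ _ _

theorem L_succ (a : ℕ) : T.L r (a + 1) = T.L r a + T.vMult r (a + 1) :=
  Finset.sum_Icc_succ_top (by omega) _

theorem L_eq_sum_range (a : ℕ) : T.L r a = ∑ j ∈ Finset.range a, T.vMult r (j + 1) := by
  induction a with
  | zero => rfl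
  | succ a ih => rw [L_succ, ih, Finset.sum_range_succ]

theorem R_mono : Monotone (T.R r) :=
  monotone_nat_of_le_succ fun a => by rw [R_succ]; omega

theorem L_mono : Monotone (T.L r) :=
  monotone_nat_of_le_succ fun a => by rw [L_succ]; omega

theorem uIdx_eq {a k : ℕ} (ha : a < T.m) (h1 : T.R r a < k) (h2 : k ≤ T.R r (a + 1)) :
    T.uIdx r k = a :=
  (getD_flatMap_replicate (T.uMult r) (fun i => i) T.m).2 a ha (k - 1)
    (by change T.R r a ≤ k - 1; omega) (by change k - 1 < T.R r (a + 1); omega)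

theorem vIdx_eq {a k : ℕ} (ha : a < T.m) (h1 : T.L r a < k) (h2 : k ≤ T.L r (a + 1)) :
    T.vIdx r k = a + 1 :=
  (getD_flatMap_replicate (fun i => T.vMult r (i + 1)) (fun i => i + 1) T.m).2 a ha (k - 1)
    (by rw [← L_eq_sum_range]; omega) (by rw [← L_eq_sum_range]; omega)

namespace IsSmoothness

variable (hr : T.IsSmoothness r)
include hr

theorem uMult_cast {a : ℕ} (ha : a < T.m) : (T.uMult r a : ℤ) = T.p (a + 1) - r a := by
  have h : r a ≤ T.p (a + 1) := by
    rcases Nat.eq_zero_or_pos a with rfl | h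
    · have := hr.1; omega
    · have := (hr.2.2 a h ha).2; omega
  simp [uMult, h]

theorem vMult_cast {a : ℕ} (ha : a < T.m) : (T.vMult r (a + 1) : ℤ) = T.p (a + 1) - r (a + 1) := by
  have h : r (a + 1) ≤ T.p (a + 1) := by
    rcases Nat.eq_or_lt_of_le (Nat.succ_le_of_lt ha) with h | h
    · have := hr.2.1; rw [← h, Nat.succ_eq_add_one] at this; omega
    · have := (hr.2.2 (a + 1) (by omega) h).2; omega
  simp [vMult, h]

/-- The number `R(a) - L(a)` of splines that start before `x_a` and end after it is the number
`r_a + 1` of smoothness conditions at `x_a`. -/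
theorem R_eq {a : ℕ} (ha : a ≤ T.m) : (T.R r a : ℤ) = T.L r a + r a + 1 := by
  induction a with
  | zero => have := hr.1; simp [R_zero, L_zero, this]
  | succ a ih =>
    have := ih (by omega)
    have h1 := hr.uMult_cast (a := a) (by omega)
    have h2 := hr.vMult_cast (a := a) (by omega)
    rw [R_succ, L_succ]
    push_cast
    omega

/-- The number `R(a + 1) - L(a)` of splines whose support contains `[x_a, x_{a+1}]` is the
dimension of the local space. -/
theorem R_succ_eq {a : ℕ} (ha : a < T.m) : T.R r (a + 1) = T.L r a + T.p (a + 1) + 1 := by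
  have h1 := hr.uMult_cast ha
  have h2 := hr.R_eq ha.le
  have := T.R_succ (r := r) a
  omega

theorem neg_one_le {a : ℕ} (ha : a ≤ T.m) : -1 ≤ r a := by
  rcases Nat.eq_zero_or_pos a with rfl | h
  · exact hr.1.ge
  rcases ha.eq_or_lt with rfl | h'
  · exact hr.2.1.ge
  · exact (hr.2.2 a h h').1

theorem L_le_R {a : ℕ} (ha : a ≤ T.m) : T.L r a ≤ T.R r a := by
  have h1 := hr.R_eq ha
  have h2 := hr.neg_one_le ha
  omega

theorem R_m : T.R r T.m = T.L r T.m := by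
  have h1 := hr.R_eq le_rfl
  have h2 := hr.2.1
  omega

theorem N_eq : T.N r = T.R r T.m := by
  have key : ∀ a, a < T.m → (T.L r (a + 1) : ℤ) = ∑ i ∈ Finset.Icc 1 (a + 1), ((T.p i : ℤ) + 1)
      - ∑ i ∈ Finset.Icc 1 a, (r i + 1) - (r (a + 1) + 1) := by
    intro a
    induction a with
    | zero =>
      intro ha
      have h := hr.vMult_cast ha
      rw [L_succ, L_zero]
      simp
      omega
    | succ a ih =>
      intro ha
      have h := hr.vMult_cast ha
      have := ih (by omega)
      rw [L_succ, Finset.sum_Icc_succ_top (by omega) (fun i => (T.p i : ℤ) + 1),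
        Finset.sum_Icc_succ_top (by omega) (fun i => r i + 1)]
      push_cast
      omega
  have h := key (T.m - 1) (by have := T.m_pos; omega)
  rw [show T.m - 1 + 1 = T.m by have := T.m_pos; omega, hr.2.1] at h
  rw [hr.R_m, N]
  omega

theorem N_eq_L : T.N r = T.L r T.m := hr.N_eq.trans hr.R_m

omit hr in
theorem u_eq {a k : ℕ} (ha : a < T.m) (h1 : T.R r a < k) (h2 : k ≤ T.R r (a + 1)) :
    T.u r k = T.x a := by
  rw [u, uIdx_eq ha h1 h2]

/-- Splines starting at `x_a` do so with smoothness increasing by one with the index, up to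
`p_{a+1} - 1` for the last one. -/
theorem ru_eq {a k : ℕ} (ha : a < T.m) (h1 : T.R r a < k) (h2 : k ≤ T.R r (a + 1)) :
    T.ru r k = (k : ℤ) - T.L r a - 2 := by
  have hset : {l : ℕ | k + l ≤ T.N r ∧ T.u r k = T.u r (k + l)} = Set.Iic (T.R r (a + 1) - k) := by
    ext l
    simp only [Set.mem_ofPred_eq, Set.mem_Iic]
    have hm : T.R r (a + 1) ≤ T.R r T.m := R_mono (by omega)
    constructor
    · rintro ⟨hl, hu⟩
      obtain ⟨b, hb, hb1, hb2⟩ := exists_block (T.R_zero (r := r)) (m := T.m) (k := k + l)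
        (by omega) (by rw [← hr.N_eq]; exact hl)
      rw [u, u, uIdx_eq ha h1 h2, uIdx_eq hb hb1 hb2] at hu
      obtain rfl := T.x_inj ha.le hb.le hu
      omega
    · intro hl
      refine ⟨by rw [hr.N_eq]; omega, ?_⟩
      rw [u, u, uIdx_eq ha h1 h2, uIdx_eq ha (k := k + l) (by omega) (by omega)]
  rw [ru, hset, csSup_Iic, uIdx_eq ha h1 h2]
  have := hr.R_succ_eq ha
  omega

omit hr in
theorem v_eq {a k : ℕ} (ha : a < T.m) (h1 : T.L r a < k) (h2 : k ≤ T.L r (a + 1)) :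
    T.v r k = T.x (a + 1) := by
  rw [v, vIdx_eq ha h1 h2]

/-- Splines ending at `x_{a+1}` do so with smoothness decreasing by one with the index, from
`p_{a+1} - 1` for the first one. -/
theorem rv_eq {a k : ℕ} (ha : a < T.m) (h1 : T.L r a < k) (h2 : k ≤ T.L r (a + 1)) :
    T.rv r k = (T.R r (a + 1) : ℤ) - 1 - k := by
  have hset : {l : ℕ | l < k ∧ T.v r k = T.v r (k - l)} = Set.Iic (k - T.L r a - 1) := by
    ext l
    simp only [Set.mem_ofPred_eq, Set.mem_Iic]
    have hm : T.L r (a + 1) ≤ T.L r T.m := L_mono (by omega)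
    constructor
    · rintro ⟨hl, hv⟩
      obtain ⟨b, hb, hb1, hb2⟩ := exists_block (T.L_zero (r := r)) (m := T.m) (k := k - l)
        (by omega) (by omega)
      rw [v, v, vIdx_eq ha h1 h2, vIdx_eq hb hb1 hb2] at hv
      obtain rfl : a = b := by
        have := T.x_inj (by omega) (by omega) hv
        omega
      omega
    · intro hl
      refine ⟨by omega, ?_⟩
      rw [v, v, vIdx_eq ha h1 h2, vIdx_eq ha (k := k - l) (by omega) (by omega)]
  rw [rv, hset, csSup_Iic, vIdx_eq ha h1 h2]
  have := hr.R_succ_eq ha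
  omega

end IsSmoothness

/-! ### Knot insertion and the knot indices -/

namespace IsKnotInsertion

variable {r' : ℕ → ℤ} {i : ℕ} (hr' : T.IsSmoothness r') (hr : T.IsSmoothness r)
  (hins : T.IsKnotInsertion r' r i)

include hins in
theorem uMult_eq {a : ℕ} (ha : a < T.m) (hai : a ≠ i) : T.uMult r' a = T.uMult r a := by
  rw [uMult, uMult, hins.2.2.2 a ha.le hai]

include hr' hr hins

theorem R_eq {a : ℕ} (ha : a ≤ T.m) :
    (a ≤ i → T.R r' a = T.R r a) ∧ (i < a → T.R r' a + 1 = T.R r a) := by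
  induction a with
  | zero => exact ⟨fun _ => rfl, by omega⟩
  | succ a ih =>
    have ih := ih (by omega)
    have hs' := T.R_succ (r := r') a
    have hs := T.R_succ (r := r) a
    rcases lt_trichotomy a i with h | rfl | h
    · have := hins.uMult_eq (a := a) (by omega) (by omega)
      omega
    · have h1 := hr.uMult_cast (a := a) (by omega)
      have h2 := hr'.uMult_cast (a := a) (by omega)
      have h3 := hins.2.2.1
      omega
    · have := hins.uMult_eq (a := a) (by omega) (by omega)
      omega

theorem L_eq {a : ℕ} (ha : a ≤ T.m) :
    (a < i → T.L r' a = T.L r a) ∧ (i ≤ a → T.L r' a + 1 = T.L r a) := by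
  have h1 := hr.R_eq ha
  have h2 := hr'.R_eq ha
  have h3 := hins.R_eq hr' hr ha
  have h4 := hins.2.2.1
  rcases eq_or_ne a i with rfl | h
  · omega
  · have := hins.2.2.2 a ha h
    omega

theorem N_eq : T.N r' + 1 = T.N r := by
  rw [hr'.N_eq, hr.N_eq]
  exact (hins.R_eq hr' hr le_rfl).2 hins.2.1

theorem one_le_L : 1 ≤ T.L r i := by
  have := (hins.L_eq hr' hr hins.2.1.le).2 le_rfl
  omega

theorem R_lt_N : T.R r i < T.N r := by
  have h1 := (hins.R_eq hr' hr (a := i + 1) hins.2.1).2 (by omega)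
  have h2 := (hins.R_eq hr' hr hins.2.1.le).1 le_rfl
  have h3 : T.R r' i ≤ T.R r' (i + 1) := R_mono (by omega)
  have h4 : T.R r (i + 1) ≤ T.R r T.m := R_mono hins.2.1
  rw [hr.N_eq]
  omega

/-- The start of the `k`-th coarse spline is the start of the `k`-th fine one if `k ≤ R(i)` and
that of the `(k + 1)`-st one otherwise. The last equation says that the orders of smoothness
there agree. -/
theorem start_eq {k : ℕ} (hk1 : 1 ≤ k) (hk : k ≤ T.N r') {q : ℕ}
    (hq : q = if k ≤ T.R r i then k else k + 1) :
    ∃ a < T.m, (T.R r' a < k ∧ k ≤ T.R r' (a + 1)) ∧ (T.R r a < q ∧ q ≤ T.R r (a + 1)) ∧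
      q + T.L r' a = k + T.L r a := by
  obtain ⟨a, ha, h1, h2⟩ := exists_block (T.R_zero (r := r')) (m := T.m) hk1
    (by rwa [← hr'.N_eq])
  have e1 := hins.R_eq hr' hr ha.le
  have e2 := hins.R_eq hr' hr (a := a + 1) ha
  have e3 := hins.L_eq hr' hr ha.le
  have e4 := (hins.R_eq hr' hr hins.2.1.le).1 le_rfl
  have hq1 : T.R r a < q ∧ q ≤ T.R r (a + 1) ∧ (q : ℤ) - T.L r a = k - T.L r' a := by
    rcases lt_or_ge a i with h | h
    · have h3 : T.R r (a + 1) ≤ T.R r i := R_mono h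
      have e2 := e2.1 h
      rw [if_pos (by omega)] at hq
      omega
    · have h3 : T.R r i ≤ T.R r a := R_mono h
      have h4 : T.R r' i ≤ T.R r' a := R_mono h
      rw [if_neg (by omega)] at hq
      omega
  exact ⟨a, ha, ⟨h1, h2⟩, ⟨hq1.1, hq1.2.1⟩, by omega⟩

/-- The end of the `k`-th coarse spline is the end of the `k`-th fine one if `k < L(i)` and
that of the `(k + 1)`-st one otherwise. The last equation says that the orders of smoothness
there agree. -/
theorem end_eq {k : ℕ} (hk1 : 1 ≤ k) (hk : k ≤ T.N r') {q : ℕ}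
    (hq : q = if k < T.L r i then k else k + 1) :
    ∃ a < T.m, (T.L r' a < k ∧ k ≤ T.L r' (a + 1)) ∧ (T.L r a < q ∧ q ≤ T.L r (a + 1)) ∧
      q + T.R r' (a + 1) = k + T.R r (a + 1) := by
  obtain ⟨a, ha, h1, h2⟩ := exists_block (T.L_zero (r := r')) (m := T.m) hk1
    (by rwa [← hr'.N_eq_L])
  have e1 := hins.L_eq hr' hr ha.le
  have e2 := hins.L_eq hr' hr (a := a + 1) ha
  have e3 := hins.R_eq hr' hr (a := a + 1) ha
  have e4 := (hins.L_eq hr' hr hins.2.1.le).2 le_rfl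
  have hq1 : T.L r a < q ∧ q ≤ T.L r (a + 1) ∧
      (T.R r (a + 1) : ℤ) - q = T.R r' (a + 1) - k := by
    rcases lt_or_ge a i with h | h
    · have h3 : T.L r' (a + 1) ≤ T.L r' i := L_mono h
      rw [if_pos (by omega)] at hq
      omega
    · have h3 : T.L r i ≤ T.L r a := L_mono h
      have h4 : T.L r' i ≤ T.L r' a := L_mono h
      rw [if_neg (by omega)] at hq
      omega
  exact ⟨a, ha, ⟨h1, h2⟩, ⟨hq1.1, hq1.2.1⟩, by omega⟩

end IsKnotInsertion

end TchebPartition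

namespace TchebPartition

variable {T : TchebPartition} {r : ℕ → ℤ} {B : ℕ → ℝ → ℝ}

/-! ### The local spaces -/

theorem Ioo_subset_element (T : TchebPartition) (a : ℕ) :
    Set.Ioo (T.x a) (T.x (a + 1)) ⊆ T.element (a + 1) := by
  intro y hy
  unfold element
  split_ifs
  · exact Set.Ioo_subset_Icc_self hy
  · exact Set.Ioo_subset_Ico_self hy

theorem element_subset_Icc (T : TchebPartition) (a : ℕ) :
    T.element (a + 1) ⊆ Set.Icc (T.x a) (T.x (a + 1)) := by
  unfold element
  split_ifs
  · exact subset_rfl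
  · exact Set.Ico_subset_Icc_self

theorem exists_contDiffOn_of_mem_ectSpace {a : ℕ} (ha : a < T.m) {f : ℝ → ℝ}
    (hf : T.restrictTo (a + 1) f ∈ T.ectSpace (a + 1)) :
    ∃ g, ContDiffOn ℝ (T.p (a + 1)) g (Set.Icc (T.x a) (T.x (a + 1))) ∧
      ∀ y ∈ T.element (a + 1), f y = g y := by
  obtain ⟨g, hg, hfg⟩ := hf
  refine ⟨g, ?_, fun y hy => (congrFun hfg ⟨y, hy⟩).symm⟩
  clear hfg
  induction hg using Submodule.span_induction with
  | mem g hg =>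
    obtain ⟨k, hk, rfl⟩ := hg
    exact contDiffOn_nestedPower (T.x_lt a ha)
      (fun j hj => T.w_contDiffOn (a + 1) (by omega) ha j hj) k 0 (by simpa using hk)
  | zero => exact contDiffOn_const
  | add f g _ _ hf hg => exact hf.add hg
  | smul c f _ hf => exact contDiffOn_const.mul hf

/-- An element of the local space that vanishes inside an element vanishes also at those end points
that belong to it. -/
theorem restrictTo_eq_zero {a : ℕ} (ha : a < T.m) {f : ℝ → ℝ}
    (hf : T.restrictTo (a + 1) f ∈ T.ectSpace (a + 1))
    (h : ∀ y ∈ Set.Ioo (T.x a) (T.x (a + 1)), f y = 0) : T.restrictTo (a + 1) f = 0 := by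
  obtain ⟨g, hg, hfg⟩ := exists_contDiffOn_of_mem_ectSpace ha hf
  have hg0 := eq_zero_on_Icc_of_Ioo (T.x_lt a ha) hg.continuousOn fun y hy => by
    rw [← hfg y (T.Ioo_subset_element a hy), h y hy]
  ext ⟨y, hy⟩
  exact (hfg y hy).trans (hg0 y (T.element_subset_Icc a hy))

theorem finrank_ectSpace {a : ℕ} (ha : a < T.m) :
    Module.finrank ℝ (T.ectSpace (a + 1)) = T.p (a + 1) + 1 := by
  set b : Fin (T.p (a + 1) + 1) → T.element (a + 1) → ℝ := fun k =>
    T.restrictTo (a + 1) (genPower (T.w (a + 1)) (T.x a) k) with hb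
  have hspan : T.ectSpace (a + 1) = Submodule.span ℝ (Set.range b) := by
    rw [ectSpace, Submodule.map_span, ← Set.image_comp]
    congr 1
    ext g
    simp only [Set.mem_image, Set.mem_Iic, Set.mem_range, hb, Function.comp_apply,
      Nat.add_sub_cancel]
    constructor
    · rintro ⟨k, hk, rfl⟩
      exact ⟨⟨k, by omega⟩, rfl⟩
    · rintro ⟨k, rfl⟩
      exact ⟨k, by omega, rfl⟩
  have hli : LinearIndependent ℝ b := by
    rw [Fintype.linearIndependent_iff]
    intro c hc k
    have h := nestedPower_coeff_eq_zero (T.x_lt a ha)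
      (fun j hj => T.w_contDiffOn (a + 1) (by omega) ha j hj)
      (fun j hj => T.w_pos (a + 1) (by omega) ha j hj) (T.p (a + 1)) 0 (by omega)
      (fun k => if h : k < T.p (a + 1) + 1 then c ⟨k, h⟩ else 0) ?_ k (by omega)
    · rwa [dif_pos k.2] at h
    · intro y hy
      have h := congrFun hc ⟨y, T.Ioo_subset_element a hy⟩
      rw [Finset.sum_apply] at h
      rw [Finset.sum_range]
      refine (Finset.sum_congr rfl fun k _ => ?_).trans h
      rw [dif_pos k.2]
      rfl
  rw [hspan, finrank_span_eq_card hli, Fintype.card_fin]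

/-- Up to the order of the local degree, the limits in `rightDeriv` and `leftDeriv` exist for
splines, so that these are not junk values and depend linearly on the spline. -/
theorem splineSpace_derivTendsto {s : ℝ → ℝ} (hs : s ∈ T.splineSpace r) {a : ℕ} (ha : a < T.m)
    {n : ℕ} (hn : n ≤ T.p (a + 1)) :
    DerivTendsto n s (𝓝[>] T.x a) (rightDeriv n s (T.x a)) ∧
      DerivTendsto n s (𝓝[<] T.x (a + 1)) (leftDeriv n s (T.x (a + 1))) := by
  obtain ⟨g, hg, hsg⟩ := exists_contDiffOn_of_mem_ectSpace ha (hs.2.1 (a + 1) (by omega) ha)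
  obtain ⟨⟨d, hd⟩, ⟨e, he⟩⟩ := exists_derivTendsto_of_contDiffOn (T.x_lt a ha)
    (hg.of_le (by exact_mod_cast hn)) fun y hy => hsg y (T.Ioo_subset_element a hy)
  rw [hd.eq_rightDeriv, he.eq_leftDeriv]
  exact ⟨hd, he⟩

theorem leftDeriv_eq_zero {s : ℝ → ℝ} {x : ℝ} (h : ∀ y < x, s y = 0) (n : ℕ) :
    leftDeriv n s x = 0 :=
  (derivTendsto_zero isOpen_Iio self_mem_nhdsWithin h).eq_leftDeriv

theorem rightDeriv_eq_zero {s : ℝ → ℝ} {x : ℝ} (h : ∀ y > x, s y = 0) (n : ℕ) :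
    rightDeriv n s x = 0 :=
  (derivTendsto_zero isOpen_Ioi self_mem_nhdsWithin h).eq_rightDeriv

/-! ### Local linear independence and end point derivatives of GTB-splines -/

namespace IsGTBSplines

variable (hr : T.IsSmoothness r) (hB : T.IsGTBSplines r B)

include hB in
theorem mem_splineSpace {k : ℕ} (h1 : 1 ≤ k) (h2 : k ≤ T.N r) : B k ∈ T.splineSpace r := by
  rw [← hB.span_eq]
  exact Submodule.subset_span ⟨k, ⟨h1, h2⟩, rfl⟩

include hB in
theorem exists_eq_sum {s : ℝ → ℝ} (hs : s ∈ T.splineSpace r) :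
    ∃ c : ℕ → ℝ, s = fun y => ∑ l ∈ Finset.Icc 1 (T.N r), c l * B l y := by
  rw [← hB.span_eq, SetLike.mem_coe, ← Finset.coe_Icc,
    Submodule.mem_span_image_finset_iff_exists_fun'] at hs
  obtain ⟨c, rfl⟩ := hs
  exact ⟨c, by ext y; simp⟩

include hB in
theorem rightDeriv_sum (c : ℕ → ℝ) {a n : ℕ} (ha : a < T.m) (hn : n ≤ T.p (a + 1)) :
    rightDeriv n (fun y => ∑ l ∈ Finset.Icc 1 (T.N r), c l * B l y) (T.x a) =
      ∑ l ∈ Finset.Icc 1 (T.N r), c l * rightDeriv n (B l) (T.x a) :=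
  (DerivTendsto.sum (fun _ hl => (splineSpace_derivTendsto
    (hB.mem_splineSpace (Finset.mem_Icc.1 hl).1 (Finset.mem_Icc.1 hl).2) ha hn).1) c).eq_rightDeriv

include hB in
theorem leftDeriv_sum (c : ℕ → ℝ) {a n : ℕ} (ha : a < T.m) (hn : n ≤ T.p (a + 1)) :
    leftDeriv n (fun y => ∑ l ∈ Finset.Icc 1 (T.N r), c l * B l y) (T.x (a + 1)) =
      ∑ l ∈ Finset.Icc 1 (T.N r), c l * leftDeriv n (B l) (T.x (a + 1)) :=
  (DerivTendsto.sum (fun _ hl => (splineSpace_derivTendsto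
    (hB.mem_splineSpace (Finset.mem_Icc.1 hl).1 (Finset.mem_Icc.1 hl).2) ha hn).2) c).eq_leftDeriv

include hr hB

theorem eq_zero_of_x_lt {b l : ℕ} (hb : b ≤ T.m) (h1 : 1 ≤ l) (h2 : l ≤ T.L r b) {y : ℝ}
    (hy : T.x b < y) : B l y = 0 := by
  obtain ⟨a, ha, ha1, ha2⟩ := exists_block (T.L_zero (r := r)) h1 h2
  have hN : l ≤ T.N r := by rw [hr.N_eq_L]; exact h2.trans (L_mono hb)
  refine hB.support l h1 hN y fun hy' => ?_
  have h := hy'.2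
  rw [IsSmoothness.v_eq (by omega) ha1 ha2] at h
  exact absurd (h.trans (T.x_le_x ha hb)) (not_le.2 hy)

theorem eq_zero_of_lt_x {b l : ℕ} (h1 : T.R r b < l) (h2 : l ≤ T.N r) {y : ℝ}
    (hy : y < T.x b) : B l y = 0 := by
  obtain ⟨a, ha, ha1, ha2⟩ := exists_block (T.R_zero (r := r)) (m := T.m) (k := l) (by omega)
    (by rwa [← hr.N_eq])
  refine hB.support l (by omega) h2 y fun hy' => ?_
  have h := hy'.1
  rw [IsSmoothness.u_eq ha ha1 ha2] at h
  have hba : b ≤ a := by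
    by_contra hab
    have : T.R r (a + 1) ≤ T.R r b := R_mono (by omega)
    omega
  exact absurd ((T.x_le_x hba ha.le).trans h) (not_le.2 hy)

/-- The splines whose support contains `[x_a, x_{a+1}]` are linearly independent on the open
interval: they are `p + 1` in number and span there a space of that dimension. -/
theorem coeff_eq_zero_of_Ioo {a : ℕ} (ha : a < T.m) {c : ℕ → ℝ}
    (h : ∀ y ∈ Set.Ioo (T.x a) (T.x (a + 1)), ∑ l ∈ Finset.Icc 1 (T.N r), c l * B l y = 0)
    {l : ℕ} (h1 : T.L r a < l) (h2 : l ≤ T.R r (a + 1)) : c l = 0 := by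
  have hR := hr.R_succ_eq ha
  have hRm : T.R r (a + 1) ≤ T.R r T.m := R_mono ha
  rw [← hr.N_eq] at hRm
  set I := Finset.Icc (T.R r (a + 1) - T.p (a + 1)) (T.R r (a + 1)) with hI
  have hIN : I ⊆ Finset.Icc 1 (T.N r) := fun l hl => by
    rw [hI, Finset.mem_Icc] at hl
    rw [Finset.mem_Icc]
    omega
  have hspan : T.ectSpace (a + 1) =
      Submodule.span ℝ (Set.range fun l : I => T.restrictTo (a + 1) (B l)) := by
    rw [← hB.local_span (a + 1) (by omega) ha, Submodule.map_span, ← Set.image_comp]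
    congr 1
    ext g
    simp [hI]
  have hli : LinearIndependent ℝ fun l : I => T.restrictTo (a + 1) (B l) := by
    rw [linearIndependent_iff_card_eq_finrank_span, Set.finrank, ← hspan, finrank_ectSpace ha,
      Fintype.card_coe, hI, Nat.card_Icc]
    omega
  have hsum : T.restrictTo (a + 1) (∑ l ∈ I, c l • B l) = 0 := by
    refine restrictTo_eq_zero ha ?_ fun y hy => ?_
    · rw [map_sum]
      refine Submodule.sum_mem _ fun l hl => ?_
      have hl := Finset.mem_Icc.1 (hIN hl)
      rw [map_smul]
      exact Submodule.smul_mem _ _ ((hB.mem_splineSpace hl.1 hl.2).2.1 (a + 1) (by omega) ha)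
    · rw [← h y hy, Finset.sum_apply]
      refine Finset.sum_subset hIN fun l hl hl' => ?_
      rw [hI, Finset.mem_Icc, not_and_or, not_le, not_le] at hl'
      rw [Finset.mem_Icc] at hl
      have h0 : B l y = 0 := by
        rcases hl' with hl' | hl'
        · exact hB.eq_zero_of_x_lt hr ha.le hl.1 (by omega) hy.1
        · exact hB.eq_zero_of_lt_x hr hl' hl.2 hy.2
      simp [h0]
  rw [map_sum, ← Finset.sum_coe_sort] at hsum
  simp only [map_smul] at hsum
  exact Fintype.linearIndependent_iff.1 hli (fun l => c l) hsum
    ⟨l, by rw [hI, Finset.mem_Icc]; omega⟩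

theorem coeff_eq_zero {c : ℕ → ℝ}
    (h : ∀ y ∈ Set.Icc (T.x 0) (T.x T.m), ∑ l ∈ Finset.Icc 1 (T.N r), c l * B l y = 0)
    {l : ℕ} (h1 : 1 ≤ l) (h2 : l ≤ T.N r) : c l = 0 := by
  obtain ⟨a, ha, ha1, ha2⟩ := exists_block (T.R_zero (r := r)) (m := T.m) h1
    (by rwa [← hr.N_eq])
  refine hB.coeff_eq_zero_of_Ioo hr ha (fun y hy => h y ⟨?_, ?_⟩)
    ((hr.L_le_R ha.le).trans_lt ha1) ha2
  · exact (T.x_le_x (by omega) ha.le).trans hy.1.le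
  · exact hy.2.le.trans (T.x_le_x ha le_rfl)

/-! ### Splines starting at a given knot -/

theorem jump_start_eq_zero {a k n : ℕ} (ha : a < T.m) (h1 : T.R r a < k)
    (h2 : k ≤ T.R r (a + 1)) (hn : n + T.L r a + 1 < k) : jump (T.x a) n (B k) = 0 := by
  have hm : T.R r (a + 1) ≤ T.R r T.m := R_mono ha
  rw [← hr.N_eq] at hm
  have h := (hB.start_smooth k (by omega) (by omega)).1 n
  rw [hr.ru_eq ha h1 h2, IsSmoothness.u_eq ha h1 h2] at h
  exact h (by omega)

theorem rightDeriv_eq_zero {a k n : ℕ} (ha : a < T.m) (h1 : T.R r a < k) (h2 : k ≤ T.N r)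
    (hn : n + T.L r a + 1 < k) : rightDeriv n (B k) (T.x a) = 0 := by
  rcases le_or_gt k (T.R r (a + 1)) with h | h
  · have hj := hB.jump_start_eq_zero hr ha h1 h hn
    rw [jump, leftDeriv_eq_zero (fun y hy => hB.eq_zero_of_lt_x hr h1 h2 hy)] at hj
    linarith
  · exact (derivTendsto_zero isOpen_Iio
      (mem_nhdsWithin_of_mem_nhds (Iio_mem_nhds (T.x_lt a ha)))
      fun y hy => hB.eq_zero_of_lt_x hr h h2 hy).eq_rightDeriv

/-- The right derivative of `B k` of order `r_u(k) + 1 = k - L(a) - 1` at its starting point `x_a`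
is the first one that does not vanish, so it has the sign of `B k`. -/
theorem rightDeriv_pos {a k n : ℕ} (ha : a < T.m) (h1 : T.R r a < k) (h2 : k ≤ T.R r (a + 1))
    (hn : n + T.L r a + 1 = k) : 0 < rightDeriv n (B k) (T.x a) := by
  have hm : T.R r (a + 1) ≤ T.R r T.m := R_mono ha
  rw [← hr.N_eq] at hm
  have hp := hr.R_succ_eq ha
  have hs := hB.mem_splineSpace (k := k) (by omega) (by omega)
  have ht := fun {j : ℕ} hj => (splineSpace_derivTendsto hs ha (n := j) hj).1.2
  refine pos_of_tendsto_iteratedDeriv_right (T.x_lt a ha) (fun y hy => ?_) (fun j hj => ?_)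
    (ht (by omega)) ?_
  · refine (hB.pos k (by omega) (by omega) y ⟨?_, hy.2.trans_le ?_⟩).le
    · rw [IsSmoothness.u_eq ha h1 h2]
      exact hy.1
    · obtain ⟨b, hb, hb1, hb2⟩ := exists_block (T.L_zero (r := r)) (m := T.m) (k := k) (by omega)
        (by rw [← hr.N_eq_L]; omega)
      rw [IsSmoothness.v_eq hb hb1 hb2]
      refine T.x_le_x ?_ hb
      by_contra hab
      have : T.L r (b + 1) ≤ T.L r a := L_mono (by omega)
      have := hr.L_le_R ha.le
      omega
  · have h := ht (j := j) (by omega)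
    rwa [hB.rightDeriv_eq_zero hr ha h1 (by omega) (by omega)] at h
  · have h := (hB.start_smooth k (by omega) (by omega)).2
    rw [hr.ru_eq ha h1 h2, IsSmoothness.u_eq ha h1 h2,
      show ((k : ℤ) - T.L r a - 2 + 1).toNat = n by omega, jump,
      leftDeriv_eq_zero (fun y hy => hB.eq_zero_of_lt_x hr h1 (by omega) hy)] at h
    exact fun h0 => h (by rw [h0, sub_zero])

/-- If only splines from the `k`-th on take part, the derivative of the order that the `k`-th
spline starts with sees the `k`-th spline alone. -/
theorem rightDeriv_sum_eq {c : ℕ → ℝ} {a k n : ℕ} (ha : a < T.m) (h1 : T.R r a < k)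
    (h2 : k ≤ T.R r (a + 1)) (hn : n + T.L r a + 1 = k)
    (hc : ∀ l, 1 ≤ l → l < k → c l = 0) :
    rightDeriv n (fun y => ∑ l ∈ Finset.Icc 1 (T.N r), c l * B l y) (T.x a) =
      c k * rightDeriv n (B k) (T.x a) := by
  have hm : T.R r (a + 1) ≤ T.R r T.m := R_mono ha
  rw [← hr.N_eq] at hm
  have hp := hr.R_succ_eq ha
  rw [hB.rightDeriv_sum c ha (by omega)]
  refine Finset.sum_eq_single_of_mem k (Finset.mem_Icc.2 ⟨by omega, by omega⟩) fun l hl hlk => ?_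
  rw [Finset.mem_Icc] at hl
  rcases lt_or_gt_of_ne hlk with h | h
  · rw [hc l hl.1 h, zero_mul]
  · rw [hB.rightDeriv_eq_zero hr ha (by omega) hl.2 (by omega), mul_zero]

/-- A spline that starts at `x_a` at least as smoothly as the `k`-th spline is a combination of
the splines from the `k`-th on. -/
theorem coeff_eq_zero_of_start {c : ℕ → ℝ} {a k : ℕ} (ha : a < T.m)
    (h2 : k ≤ T.R r (a + 1))
    (h0 : ∀ y < T.x a, ∑ l ∈ Finset.Icc 1 (T.N r), c l * B l y = 0)
    (hj : ∀ n, n + T.L r a + 1 < k →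
      jump (T.x a) n (fun y => ∑ l ∈ Finset.Icc 1 (T.N r), c l * B l y) = 0) :
    ∀ l, 1 ≤ l → l < k → c l = 0 := by
  intro l
  induction l using Nat.strong_induction_on with
  | _ l ih =>
    intro hl1 hlk
    have hLR := hr.L_le_R ha.le
    rcases le_or_gt l (T.R r a) with h | h
    -- splines that start before `x_a` are excluded by local linear independence to its left
    · obtain ⟨b, hb, hb1, hb2⟩ := exists_block (T.R_zero (r := r)) hl1 h
      refine hB.coeff_eq_zero_of_Ioo hr (hb.trans ha) (fun y hy => h0 y ?_)
        ((hr.L_le_R (hb.trans ha).le).trans_lt hb1) hb2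
      exact hy.2.trans_le (T.x_le_x hb ha.le)
    -- the others start at `x_a` with distinct orders, and the roughest one would cause a jump
    · have hn : l - T.L r a - 1 + T.L r a + 1 = l := by omega
      have h3 := hj _ (hn.trans_lt hlk)
      rw [jump, leftDeriv_eq_zero h0,
        hB.rightDeriv_sum_eq hr ha h (by omega) hn fun l' hl' h2 => ih l' h2 hl' (by omega)] at h3
      have h4 := hB.rightDeriv_pos hr ha h (by omega) hn
      exact (mul_eq_zero.1 (by linarith)).resolve_right h4.ne'

/-! ### Splines ending at a given knot -/

theorem jump_end_eq_zero {a k n : ℕ} (ha : a < T.m) (h1 : T.L r a < k)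
    (h2 : k ≤ T.L r (a + 1)) (hn : n + k < T.R r (a + 1)) :
    jump (T.x (a + 1)) n (B k) = 0 := by
  have hm : T.L r (a + 1) ≤ T.L r T.m := L_mono ha
  rw [← hr.N_eq_L] at hm
  have h := (hB.end_smooth k (by omega) (by omega)).1 n
  rw [hr.rv_eq ha h1 h2, IsSmoothness.v_eq ha h1 h2] at h
  exact h (by omega)

theorem leftDeriv_eq_zero {a k n : ℕ} (ha : a < T.m) (h1 : 1 ≤ k) (h2 : k ≤ T.L r (a + 1))
    (hn : n + k < T.R r (a + 1)) : leftDeriv n (B k) (T.x (a + 1)) = 0 := by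
  rcases lt_or_ge (T.L r a) k with h | h
  · have hj := hB.jump_end_eq_zero hr ha h h2 hn
    rw [jump, TchebPartition.rightDeriv_eq_zero
      (fun y hy => hB.eq_zero_of_x_lt hr ha h1 h2 hy)] at hj
    linarith
  · exact (derivTendsto_zero isOpen_Ioi
      (mem_nhdsWithin_of_mem_nhds (Ioi_mem_nhds (T.x_lt a ha)))
      fun y hy => hB.eq_zero_of_x_lt hr ha.le h1 h hy).eq_leftDeriv

/-- The left derivative of `B k` of order `n = r_v(k) + 1 = R(a + 1) - k` at its end point
`x_{a+1}` is the first one that does not vanish, so it has the sign `(-1) ^ n`. -/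
theorem leftDeriv_pos {a k n : ℕ} (ha : a < T.m) (h1 : T.L r a < k) (h2 : k ≤ T.L r (a + 1))
    (hn : n + k = T.R r (a + 1)) : 0 < (-1) ^ n * leftDeriv n (B k) (T.x (a + 1)) := by
  have hm : T.L r (a + 1) ≤ T.L r T.m := L_mono ha
  rw [← hr.N_eq_L] at hm
  have hp := hr.R_succ_eq ha
  have hs := hB.mem_splineSpace (k := k) (by omega) (by omega)
  have ht := fun {j : ℕ} hj => (splineSpace_derivTendsto hs ha (n := j) hj).2.2
  refine pos_of_tendsto_iteratedDeriv_left (T.x_lt a ha) (fun y hy => ?_) (fun j hj => ?_)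
    (ht (by omega)) ?_
  · refine (hB.pos k (by omega) (by omega) y ⟨lt_of_le_of_lt ?_ hy.1, ?_⟩).le
    · obtain ⟨b, hb, hb1, hb2⟩ := exists_block (T.R_zero (r := r)) (m := T.m) (k := k) (by omega)
        (by rw [← hr.N_eq]; omega)
      rw [IsSmoothness.u_eq hb hb1 hb2]
      refine T.x_le_x ?_ ha.le
      by_contra hab
      have : T.R r (a + 1) ≤ T.R r b := R_mono (by omega)
      have := hr.L_le_R (a := a + 1) ha
      omega
    · rw [IsSmoothness.v_eq ha h1 h2]
      exact hy.2
  · have h := ht (j := j) (by omega)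
    rwa [hB.leftDeriv_eq_zero hr ha (by omega) h2 (by omega)] at h
  · have h := (hB.end_smooth k (by omega) (by omega)).2
    rw [hr.rv_eq ha h1 h2, IsSmoothness.v_eq ha h1 h2,
      show ((T.R r (a + 1) : ℤ) - 1 - k + 1).toNat = n by omega, jump,
      TchebPartition.rightDeriv_eq_zero
        (fun y hy => hB.eq_zero_of_x_lt hr ha (by omega) h2 hy)] at h
    exact fun h0 => h (by rw [h0, sub_zero])

/-- If only splines up to the `k`-th take part, the derivative of the order that the `k`-th
spline ends with sees the `k`-th spline alone. -/
theorem leftDeriv_sum_eq {c : ℕ → ℝ} {a k n : ℕ} (ha : a < T.m) (h1 : T.L r a < k)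
    (h2 : k ≤ T.L r (a + 1)) (hn : n + k = T.R r (a + 1))
    (hc : ∀ l, k < l → l ≤ T.N r → c l = 0) :
    leftDeriv n (fun y => ∑ l ∈ Finset.Icc 1 (T.N r), c l * B l y) (T.x (a + 1)) =
      c k * leftDeriv n (B k) (T.x (a + 1)) := by
  have hm : T.L r (a + 1) ≤ T.L r T.m := L_mono ha
  rw [← hr.N_eq_L] at hm
  have hp := hr.R_succ_eq ha
  rw [hB.leftDeriv_sum c ha (by omega)]
  refine Finset.sum_eq_single_of_mem k (Finset.mem_Icc.2 ⟨by omega, by omega⟩) fun l hl hlk => ?_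
  rw [Finset.mem_Icc] at hl
  rcases lt_or_gt_of_ne hlk with h | h
  · rw [hB.leftDeriv_eq_zero hr ha hl.1 (by omega) (by omega), mul_zero]
  · rw [hc l h hl.2, zero_mul]

/-- A spline that ends at `x_{a+1}` at least as smoothly as the `k`-th spline is a combination of
the splines up to the `k`-th. -/
theorem coeff_eq_zero_of_end {c : ℕ → ℝ} {a k : ℕ} (ha : a < T.m) (h1 : T.L r a < k)
    (h0 : ∀ y > T.x (a + 1), ∑ l ∈ Finset.Icc 1 (T.N r), c l * B l y = 0)
    (hj : ∀ n, n + k < T.R r (a + 1) →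
      jump (T.x (a + 1)) n (fun y => ∑ l ∈ Finset.Icc 1 (T.N r), c l * B l y) = 0) :
    ∀ l, k < l → l ≤ T.N r → c l = 0 := by
  -- induction on the distance of `l` from the last index
  suffices H : ∀ j l, l + j = T.N r → k < l → c l = 0 from
    fun l hkl hl => H (T.N r - l) l (by omega) hkl
  intro j
  induction j using Nat.strong_induction_on with
  | _ j ih =>
    intro l hlj hkl
    have hLR := hr.L_le_R (a := a + 1) ha
    rcases lt_or_ge (T.L r (a + 1)) l with h | h
    · obtain ⟨b, hb, hb1, hb2⟩ := exists_block (T.L_zero (r := r)) (m := T.m) (k := l) (by omega)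
        (by rw [← hr.N_eq_L]; omega)
      have hab : a + 1 ≤ b := by
        by_contra hab
        have : T.L r (b + 1) ≤ T.L r (a + 1) := L_mono (by omega)
        omega
      refine hB.coeff_eq_zero_of_Ioo hr hb (fun y hy => h0 y ?_) hb1
        (hb2.trans (hr.L_le_R hb))
      exact (T.x_le_x hab hb.le).trans_lt hy.1
    · have hn : T.R r (a + 1) - l + l = T.R r (a + 1) := by omega
      have h3 := hj (T.R r (a + 1) - l) (by omega)
      rw [jump, TchebPartition.rightDeriv_eq_zero h0,
        hB.leftDeriv_sum_eq hr ha (by omega) h hn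
          fun l' hl' _ => ih (T.N r - l') (by omega) l' (by omega) (by omega)] at h3
      have h4 := hB.leftDeriv_pos hr ha (by omega) h hn
      have h5 : leftDeriv (T.R r (a + 1) - l) (B l) (T.x (a + 1)) ≠ 0 := by
        intro h5
        rw [h5, mul_zero] at h4
        exact lt_irrefl _ h4
      exact (mul_eq_zero.1 (by linarith)).resolve_right h5

end IsGTBSplines

end TchebPartition

namespace TchebPartition

variable {T : TchebPartition} {r r' : ℕ → ℤ} {B B' : ℕ → ℝ → ℝ} {i : ℕ}

/-! ### The two-term relation -/

theorem sum_Icc_eq_pair {N k : ℕ} {f : ℕ → ℝ} (h1 : 1 ≤ k) (h2 : k + 1 ≤ N)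
    (h : ∀ l, 1 ≤ l → l ≤ N → l ≠ k → l ≠ k + 1 → f l = 0) :
    ∑ l ∈ Finset.Icc 1 N, f l = f k + f (k + 1) := by
  rw [← Finset.sum_pair (show k ≠ k + 1 by omega)]
  refine (Finset.sum_subset (fun l hl => ?_) fun l hl hl' => ?_).symm
  · rw [Finset.mem_insert, Finset.mem_singleton] at hl
    rw [Finset.mem_Icc]
    omega
  · rw [Finset.mem_Icc] at hl
    rw [Finset.mem_insert, Finset.mem_singleton] at hl'
    exact h l hl.1 hl.2 (by omega) (by omega)

/-- Regrouping a sum of two-term expressions by the second index. -/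
theorem sum_two_term (α β d b : ℕ → ℝ) (M : ℕ) :
    ∑ k ∈ Finset.Icc 1 M, d k * (α k * b k + β (k + 1) * b (k + 1)) =
      ∑ l ∈ Finset.Icc 1 M, (β l * d (l - 1) + α l * d l) * b l
        + β (M + 1) * d M * b (M + 1) - β 1 * d 0 * b 1 := by
  induction M with
  | zero => simp
  | succ M ih =>
    rw [Finset.sum_Icc_succ_top (by omega), ih, Finset.sum_Icc_succ_top (by omega),
      Nat.add_sub_cancel]
    ring

theorem splineSpace_subset (hins : T.IsKnotInsertion r' r i) :
    T.splineSpace r' ⊆ T.splineSpace r := by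
  refine fun s hs => ⟨hs.1, hs.2.1, fun a h1 h2 j hj => hs.2.2 a h1 h2 j ?_⟩
  rcases eq_or_ne a i with rfl | h
  · have := hins.2.2.1
    omega
  · rw [hins.2.2.2 a h2.le h]
    exact hj

theorem IsGTBSplines.jump_sum (hB : T.IsGTBSplines r B) (c : ℕ → ℝ) {n : ℕ} (h1 : 1 ≤ i)
    (h2 : i < T.m) (hn1 : n ≤ T.p i) (hn2 : n ≤ T.p (i + 1)) :
    jump (T.x i) n (fun y => ∑ l ∈ Finset.Icc 1 (T.N r), c l * B l y) =
      ∑ l ∈ Finset.Icc 1 (T.N r), c l * jump (T.x i) n (B l) := by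
  obtain ⟨a, rfl⟩ : ∃ a, i = a + 1 := ⟨i - 1, by omega⟩
  rw [jump, hB.rightDeriv_sum c h2 hn2, hB.leftDeriv_sum c (by omega) hn1,
    ← Finset.sum_sub_distrib]
  exact Finset.sum_congr rfl fun l _ => (mul_sub _ _ _).symm

/-- A coarse spline starts like one fine spline and ends like the same one or the next one, so it
is a combination of these two. Where both are needed, comparison of the leading derivatives at the
two ends of the support gives the signs of the coefficients, and the smoothness of the coarse
spline at the new knot gives their ratio. -/
theorem IsGTBSplines.exists_two_term (hr' : T.IsSmoothness r') (hr : T.IsSmoothness r)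
    (hins : T.IsKnotInsertion r' r i) (hB' : T.IsGTBSplines r' B') (hB : T.IsGTBSplines r B)
    {k : ℕ} (h1 : 1 ≤ k) (h2 : k < T.N r) :
    ∃ a b : ℝ, (∀ y, B' k y = a * B k y + b * B (k + 1) y) ∧
      (k < T.L r i → b = 0) ∧ (T.R r i < k → a = 0) ∧
      (T.L r i ≤ k → k ≤ T.R r i → 0 < a ∧ 0 < b ∧
        a * jump (T.x i) (r i + 1).toNat (B k) +
          b * jump (T.x i) (r i + 1).toNat (B (k + 1)) = 0) := by
  have hN := hins.N_eq hr' hr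
  have hLR := hr.L_le_R hins.2.1.le
  have hmem := hB'.mem_splineSpace h1 (by omega)
  obtain ⟨c, hc⟩ := hB.exists_eq_sum (splineSpace_subset hins hmem)
  obtain ⟨s, hs, ⟨s1, s2⟩, ⟨s3, s4⟩, s5⟩ := hins.start_eq hr' hr h1 (by omega) rfl
  obtain ⟨e, he, ⟨e1, e2⟩, ⟨e3, e4⟩, e5⟩ := hins.end_eq hr' hr h1 (by omega) rfl
  have hlow := hB.coeff_eq_zero_of_start (c := c) hr hs s4
    (fun y hy => (congrFun hc y).symm.trans
      (hB'.eq_zero_of_lt_x hr' s1 (by omega) hy))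
    (fun n hn => by rw [← hc]; exact hB'.jump_start_eq_zero hr' hs s1 s2 (by omega))
  have hhigh := hB.coeff_eq_zero_of_end (c := c) hr he e3
    (fun y hy => (congrFun hc y).symm.trans
      (hB'.eq_zero_of_x_lt hr' he h1 e2 hy))
    (fun n hn => by rw [← hc]; exact hB'.jump_end_eq_zero hr' he e1 e2 (by omega))
  have hzero : ∀ l, 1 ≤ l → l ≤ T.N r → l ≠ k → l ≠ k + 1 → c l = 0 := by
    intro l hl1 hl2 hl3 hl4
    rcases lt_or_gt_of_ne hl3 with h | h
    · exact hlow l hl1 (by split_ifs <;> omega)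
    · exact hhigh l (by split_ifs <;> omega) hl2
  refine ⟨c k, c (k + 1), fun y => ?_, fun h => ?_, fun h => ?_, fun hL hR => ⟨?_, ?_, ?_⟩⟩
  · exact (congrFun hc y).trans (sum_Icc_eq_pair h1 h2 fun l hl1 hl2 hl3 hl4 => by
      rw [hzero l hl1 hl2 hl3 hl4, zero_mul])
  · exact hhigh (k + 1) (by rw [if_pos h]; omega) h2
  · exact hlow k h1 (by rw [if_neg (not_le.2 h)]; omega)
  · simp only [if_pos hR] at s3 s4 s5 hlow
    have hLs := hr.L_le_R hs.le
    have hn : k - T.L r s - 1 + T.L r s + 1 = k := by omega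
    have hpos := hB'.rightDeriv_pos (n := k - T.L r s - 1) hr' hs s1 s2 (by omega)
    rw [hc, hB.rightDeriv_sum_eq hr hs s3 s4 hn hlow] at hpos
    exact pos_of_mul_pos_left hpos (hB.rightDeriv_pos hr hs s3 s4 hn).le
  · simp only [if_neg (not_lt.2 hL)] at e3 e4 e5 hhigh
    have hLe := hr.L_le_R (a := e + 1) he
    have hn : T.R r (e + 1) - (k + 1) + (k + 1) = T.R r (e + 1) := by omega
    have hpos := hB'.leftDeriv_pos (n := T.R r (e + 1) - (k + 1)) hr' he e1 e2 (by omega)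
    rw [hc, hB.leftDeriv_sum_eq hr he e3 e4 hn hhigh, mul_left_comm] at hpos
    exact pos_of_mul_pos_left hpos (hB.leftDeriv_pos hr he e3 e4 hn).le
  · have hi := hr'.2.2 i hins.1 hins.2.1
    have hi' := hr.neg_one_le hins.2.1.le
    have hri := hins.2.2.1
    have hj := hmem.2.2 i hins.1 hins.2.1 (r i + 1).toNat (by omega)
    rw [hc, hB.jump_sum c hins.1 hins.2.1 (by omega) (by omega),
      sum_Icc_eq_pair h1 h2 fun l hl1 hl2 hl3 hl4 => by
        rw [hzero l hl1 hl2 hl3 hl4, zero_mul]] at hj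
    exact hj

/-- The last spline that ends at `x_i` is exactly `C^{r_i}` there. -/
theorem IsGTBSplines.jump_L_ne_zero (hr : T.IsSmoothness r) (hB : T.IsGTBSplines r B)
    (hi : 0 < i) (him : i ≤ T.m) (hL : T.L r (i - 1) < T.L r i) :
    jump (T.x i) (r i + 1).toNat (B (T.L r i)) ≠ 0 := by
  obtain ⟨a, rfl⟩ : ∃ a, i = a + 1 := ⟨i - 1, by omega⟩
  have hm : T.L r (a + 1) ≤ T.L r T.m := L_mono him
  rw [← hr.N_eq_L] at hm
  have h := (hB.end_smooth (T.L r (a + 1)) (by omega) hm).2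
  have hR := hr.R_eq him
  rw [hr.rv_eq him hL le_rfl, IsSmoothness.v_eq him hL le_rfl] at h
  rwa [show (T.R r (a + 1) : ℤ) - 1 - T.L r (a + 1) + 1 = r (a + 1) + 1 by omega] at h

end TchebPartition

/-! ### Knot insertion -/

theorem mainTheorem2 (T : TchebPartition) (r' r : ℕ → ℤ) (i : ℕ)
    (hr' : T.IsSmoothness r') (hr : T.IsSmoothness r) (hins : T.IsKnotInsertion r' r i)
    (B' B : ℕ → ℝ → ℝ) (hB' : T.IsGTBSplines r' B') (hB : T.IsGTBSplines r B) :
    ∃ α β : ℕ → ℝ,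
      -- the two-term relation that defines the weights
      (∀ k, 1 ≤ k → k ≤ T.N r - 1 → ∀ y ∈ Set.Icc (T.x 0) (T.x T.m),
        B' k y = α k * B k y + β (k + 1) * B (k + 1) y) ∧
      (∀ k, 1 ≤ k → k < T.L r i → α k = 1 ∧ β (k + 1) = 0) ∧
      (∀ k, T.L r i ≤ k → k ≤ T.R r i →
        0 < α k ∧ 0 < β (k + 1) ∧
        jump (T.x i) (r i + 1).toNat (B (k + 1)) ≠ 0 ∧
        β (k + 1) = -α k * (jump (T.x i) (r i + 1).toNat (B k) /
          jump (T.x i) (r i + 1).toNat (B (k + 1)))) ∧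
      (∀ k, T.R r i < k → k < T.N r → α k = 0 ∧ β (k + 1) = 1) ∧
      -- the weights add up to one
      α (T.L r i) = 1 ∧ β (T.R r i + 1) = 1 ∧
      (∀ k, T.L r i < k → k ≤ T.R r i → α k + β k = 1) ∧
      -- the new coefficients
      ∀ d' : ℕ → ℝ, ∀ y ∈ Set.Icc (T.x 0) (T.x T.m),
        ∑ k ∈ Finset.Icc 1 (T.N r - 1), d' k * B' k y =
          ∑ k ∈ Finset.Icc 1 (T.N r), T.insertedCoeff r i α β d' k * B k y := by
  have hN := hins.N_eq hr' hr
  have hL1 := hins.one_le_L hr' hr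
  have hLR := hr.L_le_R hins.2.1.le
  have hRN := hins.R_lt_N hr' hr
  have hex : ∀ k, ∃ a b : ℝ, 1 ≤ k → k < T.N r →
      (∀ y, B' k y = a * B k y + b * B (k + 1) y) ∧
      (k < T.L r i → b = 0) ∧ (T.R r i < k → a = 0) ∧
      (T.L r i ≤ k → k ≤ T.R r i → 0 < a ∧ 0 < b ∧
        a * jump (T.x i) (r i + 1).toNat (B k) +
          b * jump (T.x i) (r i + 1).toNat (B (k + 1)) = 0) := by
    intro k
    by_cases h : 1 ≤ k ∧ k < T.N r
    · obtain ⟨a, b, hab⟩ := TchebPartition.IsGTBSplines.exists_two_term hr' hr hins hB' hB h.1 h.2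
      exact ⟨a, b, fun _ _ => hab⟩
    · exact ⟨0, 0, fun h1 h2 => absurd ⟨h1, h2⟩ h⟩
  choose a b hab using hex
  -- with `α N = 0` and `β 1 = 0` the regrouped sums need no separate boundary terms
  set α : ℕ → ℝ := fun k => if k < T.N r then a k else 0 with hα
  set β : ℕ → ℝ := fun k => if 1 < k then b (k - 1) else 0 with hβ
  have hαk : ∀ k, k < T.N r → α k = a k := fun k h => if_pos h
  have hαN : α (T.N r) = 0 := if_neg (lt_irrefl _)
  have hβk : ∀ k, 1 ≤ k → β (k + 1) = b k := fun k h => by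
    simp only [hβ, if_pos (show 1 < k + 1 by omega), Nat.add_sub_cancel]
  have hβ1 : β 1 = 0 := if_neg (lt_irrefl _)
  have htwo : ∀ k, 1 ≤ k → k < T.N r → ∀ y, B' k y = α k * B k y + β (k + 1) * B (k + 1) y :=
    fun k h1 h2 y => by rw [hαk k h2, hβk k h1]; exact (hab k h1 h2).1 y
  have hsum : ∀ (d : ℕ → ℝ) (y : ℝ), ∑ k ∈ Finset.Icc 1 (T.N r - 1), d k * B' k y =
      ∑ l ∈ Finset.Icc 1 (T.N r), (β l * d (l - 1) + α l * d l) * B l y := by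
    intro d y
    obtain ⟨M, hM⟩ : ∃ M, T.N r = M + 1 := ⟨T.N r - 1, by omega⟩
    have h := TchebPartition.sum_two_term α β d (fun k => B k y) M
    rw [hM] at hαN htwo ⊢
    rw [Finset.sum_Icc_succ_top (by omega), hαN, Nat.add_sub_cancel]
    rw [hβ1] at h
    refine (Finset.sum_congr rfl fun k hk => ?_).trans (h.trans (by ring))
    rw [Finset.mem_Icc] at hk
    rw [htwo k hk.1 (by omega)]
  -- compare the partitions of unity
  have hone : ∀ l, 1 ≤ l → l ≤ T.N r → α l + β l = 1 := by
    intro l h1 h2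
    have h := hB.coeff_eq_zero hr (c := fun l => α l + β l - 1) (fun y hy => ?_) h1 h2
    · linarith
    · have e1 := hB.sum_eq_one y hy
      have e2 := hB'.sum_eq_one y hy
      have e3 := hsum (fun _ => 1) y
      rw [show T.N r' = T.N r - 1 by omega] at e2
      simp only [one_mul, mul_one, e2] at e3
      simp only [sub_mul, one_mul, Finset.sum_sub_distrib, e1, add_comm (α _)]
      linarith
  have hβL : ∀ l, 1 ≤ l → l ≤ T.L r i → β l = 0 := by
    intro l h1 h2
    rcases h1.eq_or_lt with rfl | h
    · exact hβ1
    · obtain ⟨k, rfl⟩ : ∃ k, l = k + 1 := ⟨l - 1, by omega⟩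
      rw [hβk k (by omega)]
      exact (hab k (by omega) (by omega)).2.1 (by omega)
  have hαR : ∀ l, T.R r i < l → l ≤ T.N r → α l = 0 := by
    intro l h1 h2
    rcases h2.eq_or_lt with rfl | h
    · exact hαN
    · rw [hαk l h]
      exact (hab l (by omega) h).2.2.1 h1
  have hαL : ∀ l, 1 ≤ l → l ≤ T.L r i → α l = 1 := fun l h1 h2 => by
    have := hone l h1 (by omega)
    rwa [hβL l h1 h2, add_zero] at this
  have hβR : ∀ l, T.R r i < l → l ≤ T.N r → β l = 1 := fun l h1 h2 => by
    have := hone l (by omega) h2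
    rwa [hαR l h1 h2, zero_add] at this
  have hmid : ∀ k, T.L r i ≤ k → k ≤ T.R r i → 0 < α k ∧ 0 < β (k + 1) ∧
      α k * jump (T.x i) (r i + 1).toNat (B k) +
        β (k + 1) * jump (T.x i) (r i + 1).toNat (B (k + 1)) = 0 := fun k h1 h2 => by
    rw [hαk k (by omega), hβk k (by omega)]
    exact (hab k (by omega) (by omega)).2.2.2 h1 h2
  -- the jump is nonzero for the spline that ends at `x_i`, and the two-term relation for the jumps
  -- carries this on to the next ones
  have hjump : ∀ k, T.L r i ≤ k → k ≤ T.R r i + 1 →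
      jump (T.x i) (r i + 1).toNat (B k) ≠ 0 := by
    intro k hk
    induction k, hk using Nat.le_induction with
    | base =>
      intro _
      refine hB.jump_L_ne_zero hr hins.1 hins.2.1.le ?_
      have h1 := (hins.L_eq hr' hr hins.2.1.le).2 le_rfl
      have h2 := (hins.L_eq hr' hr (a := i - 1) (by have := hins.2.1; omega)).1
        (by have := hins.1; omega)
      have h3 : T.L r' (i - 1) ≤ T.L r' i := TchebPartition.L_mono (by omega)
      omega
    | succ k hk ih =>
      intro hkR h0
      obtain ⟨h1, -, h3⟩ := hmid k hk (by omega)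
      rw [h0, mul_zero, add_zero] at h3
      exact (mul_ne_zero h1.ne' (ih (by omega))) h3
  refine ⟨α, β, fun k h1 h2 y _ => htwo k h1 (by omega) y,
    fun k h1 h2 => ⟨hαL k h1 h2.le, hβL (k + 1) (by omega) h2⟩, fun k h1 h2 => ?_,
    fun k h1 h2 => ⟨hαR k h1 h2.le, hβR (k + 1) (by omega) h2⟩, hαL _ hL1 le_rfl,
    hβR _ (by omega) hRN, fun k h1 h2 => hone k (by omega) (by omega), fun d' y _ => ?_⟩
  · obtain ⟨hα0, hβ0, hj⟩ := hmid k h1 h2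
    have hne := hjump (k + 1) (by omega) (by omega)
    refine ⟨hα0, hβ0, hne, ?_⟩
    field_simp
    linarith
  · rw [hsum d' y]
    refine Finset.sum_congr rfl fun l hl => ?_
    rw [Finset.mem_Icc] at hl
    unfold TchebPartition.insertedCoeff
    split_ifs with h1 h2
    · rw [hαL l hl.1 h1, hβL l hl.1 h1]
      ring
    · rfl
    · rw [hαR l (by omega) hl.2, hβR l (by omega) hl.2]
      ring
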